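/- Let $\mathbb K$ be a field of characteristic zero and $\Xi$ a set of colors. Let $P$ be a $\Xi$-colored dg pseudo-cooperad over $\mathbb K$ (a cooperad without counit) with an ascending filtration by graded subcollections $0=\mathcal F^0P\subset\mathcal F^1P\subset\mathcal F^2P\subset\cdots$ such that $P=\bigcup_m\mathcal F^mP$, $\partial_P(\mathcal F^mP)\subset\mathcal F^{m-1}P$, and $\Delta_{\mathbf t}(\mathcal F^mP)\subset\sum_{m_1+\dots+m_k=m}\mathcal F^{m_1}P\otimes\cdots\otimes\mathcal F^{m_k}P$ for every comultiplication $\Delta_{\mathbf t}$ of $P$, where $\mathbf t$ is a $\Xi$-colored tree with $k$ nodal vertices. (If $\Xi$ is infinite, it is part of the notion of pseudo-cooperad that for each $x\in P$ only finitely many $\Delta_{\mathbf t}(x)$, $\mathbf t$ running over the isomorphism classes of trees with two nodal vertices and the leaves of $x$, are nonzero; for finite $\Xi$ this is automatic.) For a $\Xi$-colored dg operad $\mathcal O$ over $\mathbb K$ let $\mathrm{Conv}(P,\mathcal O)$ be the convolution dg Lie algebra: its elements of degree $p$ are the morphisms of collections $\varphi\colon P\to\mathcal O$ of degree $p$ (equivariant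 for the permutations of the inputs), $\partial\varphi=\partial_{\mathcal O}\circ\varphi-(-1)^{|\varphi|}\varphi\circ\partial_P$, and $[\varphi,\psi]=\varphi\bullet\psi-(-1)^{|\varphi||\psi|}\psi\bullet\varphi$ with $\varphi\bullet\psi=\sum_{\mathbf t}\mu_{\mathbf t}\circ(\varphi\otimes\psi)\circ\Delta_{\mathbf t}$, where $\mathbf t$ runs over the isomorphism classes of trees with two nodal vertices and given leaves, and $\mu_{\mathbf t}$ is the corresponding multiplication of $\mathcal O$. For $m\ge1$ put $\mathcal F_m\mathrm{Conv}(P,\mathcal O)=\{\varphi : \varphi|_{\mathcal F^{m-1}P}=0\}$. Proposition. Let $f\colon\mathcal A\to\mathcal B$ be a quasi-isomorphism of $\Xi$-colored dg operads over $\mathbb K$ and $m\ge1$. Then $\mathcal F_m\mathrm{Conv}(P,\mathcal A)$ and $\mathcal F_m\mathrm{Conv}(P,\mathcal B)$ are closed under the differentials and the brackets, and $f_*\colon\varphi\mapsto f\circ\varphi$ restricts to a map $$\mathcal F_m\mathrm{Conv}(P,\mathcal A)\longrightarrow\mathcal F_m\mathrm{Conv}(P,\mathcal B)$$ which preserves the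 degrees, the differentials and the brackets and induces an isomorphism on cohomology; that is, this restriction is a quasi-isomorphism of dg Lie algebras. -/

import Mathlib

open scoped TensorProduct

namespace ConvOperad

universe u w v v₁ v₂ v₃

/-! ## Graded subspaces, signs, cohomology -/

section Graded

variable {K : Type u} [Field K]
variable {M : Type*} [AddCommGroup M] [Module K M] {N : Type*} [AddCommGroup N] [Module K N]

/-- The image of `G ⊗ H` in `M ⊗ N`, for subspaces `G` of `M` and `H` of `N`. -/
def tensorSub (G : Submodule K M) (H : Submodule K N) : Submodule K (M ⊗[K] N) :=
  LinearMap.range (TensorProduct.map G.subtype H.subtype)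

/-- The subspace `∑_{i + j = k} G i ⊗ H j` of `M ⊗ N`. It is used for gradings (`ι = ℤ`) and for
ascending filtrations (`ι = ℕ`). -/
def tensorSum {ι : Type*} [Add ι] (G : ι → Submodule K M) (H : ι → Submodule K N) (k : ι) :
    Submodule K (M ⊗[K] N) :=
  ⨆ (p : ι × ι) (_ : p.1 + p.2 = k), tensorSub (G p.1) (H p.2)

/-- For a graded vector space `M = ⨁ G i`, the operator `v ↦ (-1) ^ (q * |v|) v`. -/
noncomputable def signTwist (G : ℤ → Submodule K M) (hG : DirectSum.IsInternal G) (q : ℤ) :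
    M →ₗ[K] M :=
  (DirectSum.toModule K ℤ M fun i => (q * i).negOnePow • (G i).subtype) ∘ₗ
    (LinearEquiv.ofBijective (DirectSum.coeLinearMap G) hG).symm.toLinearMap

theorem signTwist_of_mem (G : ℤ → Submodule K M) (hG : DirectSum.IsInternal G) (q i : ℤ) {x : M}
    (hx : x ∈ G i) : signTwist G hG q x = (q * i).negOnePow • x := by
  have h : (LinearEquiv.ofBijective (DirectSum.coeLinearMap G) hG).symm x
      = DirectSum.lof K ℤ (fun i => G i) i ⟨x, hx⟩ := by
    rw [LinearEquiv.symm_apply_eq]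
    exact (DirectSum.coeLinearMap_lof G i ⟨x, hx⟩).symm
  simp [signTwist, h, DirectSum.toModule_lof]

/-- The Koszul symmetry `v ⊗ w ↦ (-1) ^ (|v| * |w|) w ⊗ v`. With `ε v = (-1) ^ |v| v`, the sign is
produced by the operator `(1 ⊗ 1 + ε ⊗ 1 + 1 ⊗ ε - ε ⊗ ε) / 2`, see `koszulSwap_of_mem`. -/
noncomputable def koszulSwap (G : ℤ → Submodule K M) (hG : DirectSum.IsInternal G)
    (H : ℤ → Submodule K N) (hH : DirectSum.IsInternal H) : M ⊗[K] N →ₗ[K] N ⊗[K] M :=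
  (TensorProduct.comm K M N).toLinearMap ∘ₗ ((2 : K)⁻¹ •
    (LinearMap.id + TensorProduct.map (signTwist G hG 1) LinearMap.id
      + TensorProduct.map LinearMap.id (signTwist H hH 1)
      - TensorProduct.map (signTwist G hG 1) (signTwist H hH 1)))

theorem koszulSwap_of_mem [CharZero K] (G : ℤ → Submodule K M) (hG : DirectSum.IsInternal G)
    (H : ℤ → Submodule K N) (hH : DirectSum.IsInternal H) (i j : ℤ) {x : M} {y : N}
    (hx : x ∈ G i) (hy : y ∈ H j) :
    koszulSwap G hG H hH (x ⊗ₜ y) = (i * j).negOnePow • (y ⊗ₜ[K] x) := by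
  have h2 : (2 : K) ≠ 0 := two_ne_zero
  simp only [koszulSwap, LinearMap.comp_apply, LinearMap.smul_apply, LinearMap.sub_apply,
    LinearMap.add_apply, LinearMap.id_apply, TensorProduct.map_tmul,
    signTwist_of_mem G hG 1 i hx, signTwist_of_mem H hH 1 j hy, one_mul]
  rcases Int.even_or_odd i with hi | hi <;> rcases Int.even_or_odd j with hj | hj
  · rw [Int.negOnePow_even i hi, Int.negOnePow_even j hj, Int.negOnePow_even _ (hi.mul_right j)]
    simp only [one_smul, add_sub_cancel_right, ← two_smul K (x ⊗ₜ[K] y), smul_smul,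
      inv_mul_cancel₀ h2]
    simp
  · rw [Int.negOnePow_even i hi, Int.negOnePow_odd j hj, Int.negOnePow_even _ (hi.mul_right j)]
    simp only [one_smul, add_sub_cancel_right, ← two_smul K (x ⊗ₜ[K] y), smul_smul,
      inv_mul_cancel₀ h2]
    simp
  · rw [Int.negOnePow_odd i hi, Int.negOnePow_even j hj, Int.negOnePow_even _ (hj.mul_left i)]
    simp only [one_smul, Units.neg_smul, TensorProduct.neg_tmul, sub_neg_eq_add]
    rw [add_neg_cancel, zero_add, ← two_smul K (x ⊗ₜ[K] y), smul_smul, inv_mul_cancel₀ h2]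
    simp
  · rw [Int.negOnePow_odd i hi, Int.negOnePow_odd j hj, Int.negOnePow_odd _ (hi.mul hj)]
    simp only [one_smul, Units.neg_smul, TensorProduct.neg_tmul, TensorProduct.tmul_neg, neg_neg]
    rw [add_neg_cancel, zero_add, ← neg_add', ← two_smul K (x ⊗ₜ[K] y), smul_neg, smul_smul,
      inv_mul_cancel₀ h2]
    simp

/-- A cochain complex `⋯ → G i → G (i + 1) → ⋯`, presented by a family of subspaces `G i` of a vector
space and linear maps `d i` on it: `d i` carries `G i` to `G (i + 1)` and `d (i + 1) ∘ d i`
vanishes on `G i`. (The subspaces `G i` need not span the ambient space.) -/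
structure IsComplex (G : ℤ → Submodule K M) (d : ℤ → M →ₗ[K] M) : Prop where
  d_mem : ∀ i, ∀ x ∈ G i, d i x ∈ G (i + 1)
  d_d : ∀ i, ∀ x ∈ G i, d (i + 1) (d i x) = 0

/-- Cocycles of degree `i`. -/
def cocycles (G : ℤ → Submodule K M) (d : ℤ → M →ₗ[K] M) (i : ℤ) : Submodule K M :=
  G i ⊓ LinearMap.ker (d i)

/-- Coboundaries of degree `i`. -/
def coboundaries (G : ℤ → Submodule K M) (d : ℤ → M →ₗ[K] M) (i : ℤ) : Submodule K M :=
  (G (i - 1)).map (d (i - 1))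

/-- Cohomology in degree `i`. -/
abbrev Cohomology (G : ℤ → Submodule K M) (d : ℤ → M →ₗ[K] M) (i : ℤ) : Type _ :=
  cocycles G d i ⧸ (coboundaries G d i).submoduleOf (cocycles G d i)

/-- `f` is a cochain map of degree zero from `(G, d)` to `(H, d')`. -/
structure IsCochainMap (G : ℤ → Submodule K M) (d : ℤ → M →ₗ[K] M)
    (H : ℤ → Submodule K N) (d' : ℤ → N →ₗ[K] N) (f : M →ₗ[K] N) : Prop where
  map_mem : ∀ i, ∀ x ∈ G i, f x ∈ H i
  comm : ∀ i, ∀ x ∈ G i, f (d i x) = d' i (f x)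

/-- The map induced on cohomology. -/
def cohomologyMap {G : ℤ → Submodule K M} {d : ℤ → M →ₗ[K] M}
    {H : ℤ → Submodule K N} {d' : ℤ → N →ₗ[K] N} {f : M →ₗ[K] N}
    (hf : IsCochainMap G d H d' f) (i : ℤ) : Cohomology G d i →ₗ[K] Cohomology H d' i :=
  Submodule.mapQ _ _
    (f.restrict (p := cocycles G d i) (q := cocycles H d' i) (fun x hx =>
      ⟨hf.map_mem i x hx.1, by
        have h0 : d i x = 0 := hx.2
        have h1 := hf.comm i x hx.1
        rw [h0, map_zero] at h1
        exact h1.symm⟩))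
    (by
      rintro ⟨x, hx⟩ ⟨z, hz, hzx⟩
      exact ⟨f z, hf.map_mem _ z hz, by
        rw [← hf.comm _ z hz, hzx]
        rfl⟩)

/-- `f` is a quasi-isomorphism of cochain complexes. -/
def IsQuasiIso (G : ℤ → Submodule K M) (d : ℤ → M →ₗ[K] M)
    (H : ℤ → Submodule K N) (d' : ℤ → N →ₗ[K] N) (f : M →ₗ[K] N) : Prop :=
  IsComplex G d ∧ IsComplex H d' ∧
    ∃ hf : IsCochainMap G d H d' f, ∀ i, Function.Bijective (cohomologyMap hf i)

end Graded

/-! ## Coloured finite sets -/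

/-- A finite set whose elements (the incoming edges of a corolla) are coloured by `Ξ`. -/
structure CSet (Ξ : Type w) where
  carrier : Type
  [finite : Finite carrier]
  color : carrier → Ξ

attribute [instance] CSet.finite

/-- Colour-preserving bijections. -/
structure CIso {Ξ : Type w} (S T : CSet Ξ) where
  toEquiv : S.carrier ≃ T.carrier
  color_eq : ∀ s, T.color (toEquiv s) = S.color s

namespace CIso

variable {Ξ : Type w} {S T U : CSet Ξ}

def refl (S : CSet Ξ) : CIso S S := ⟨Equiv.refl _, fun _ => rfl⟩

def symm (e : CIso S T) : CIso T S :=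
  ⟨e.toEquiv.symm, fun t => by rw [← e.color_eq, Equiv.apply_symm_apply]⟩

def trans (e : CIso S T) (e' : CIso T U) : CIso S U :=
  ⟨e.toEquiv.trans e'.toEquiv, fun s => (e'.color_eq _).trans (e.color_eq s)⟩

end CIso

namespace CSet

variable {Ξ : Type w}

/-- One element, of colour `ξ`. -/
def single (ξ : Ξ) : CSet Ξ := ⟨Unit, fun _ => ξ⟩

/-- `(S ∖ {s}) ⊔ T`: the leaves of the tree with two vertices obtained by grafting the corolla
with inputs `T` into the input `s` of the corolla with inputs `S`. -/
def ins (S : CSet Ξ) (s : S.carrier) (T : CSet Ξ) : CSet Ξ :=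
  ⟨{x : S.carrier // x ≠ s} ⊕ T.carrier, Sum.elim (fun x => S.color x.1) T.color⟩

/-- Functoriality of `ins`. -/
def insMap {S S' T T' : CSet Ξ} (e : CIso S S') (s : S.carrier) (e' : CIso T T') :
    CIso (S.ins s T) (S'.ins (e.toEquiv s) T') where
  toEquiv := Equiv.sumCongr (e.toEquiv.subtypeEquiv fun _ => e.toEquiv.injective.ne_iff.symm)
    e'.toEquiv
  color_eq := by
    rintro (x | x)
    · exact e.color_eq x.1
    · exact e'.color_eq x

/-- `(S ∖ {s}) ⊔ {s} ≅ S`. -/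
noncomputable def insSingle (S : CSet Ξ) (s : S.carrier) {η : Ξ} (h : S.color s = η) :
    CIso (S.ins s (single η)) S where
  toEquiv := Equiv.ofBijective (Sum.elim (fun x => x.1) (fun _ => s) :
      {x : S.carrier // x ≠ s} ⊕ Unit → S.carrier) (by
    constructor
    · rintro (⟨x, hx⟩ | x) (⟨y, hy⟩ | y) hxy
      · obtain rfl : x = y := hxy
        rfl
      · exact absurd hxy hx
      · exact absurd hxy.symm hy
      · rfl
    · intro y
      by_cases hy : y = s
      · exact ⟨Sum.inr (), hy.symm⟩
      · exact ⟨Sum.inl ⟨y, hy⟩, rfl⟩)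
  color_eq := by
    rintro (x | x)
    · rfl
    · exact h

/-- `({*} ∖ {*}) ⊔ T ≅ T`. -/
noncomputable def singleIns (ξ : Ξ) (T : CSet Ξ) :
    CIso ((single ξ).ins () T) T :=
  CIso.symm
    { toEquiv := Equiv.ofBijective (Sum.inr :
        T.carrier → {x : Unit // x ≠ ()} ⊕ T.carrier) (by
          refine ⟨Sum.inr_injective, ?_⟩
          rintro (⟨x, hx⟩ | x)
          · exact absurd rfl hx
          · exact ⟨x, rfl⟩)
      color_eq := fun _ => rfl }

/-- Sequential grafting: `(((S ∖ {s}) ⊔ T) ∖ {t}) ⊔ U ≅ (S ∖ {s}) ⊔ ((T ∖ {t}) ⊔ U)`. -/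
def insAssoc (S : CSet Ξ) (s : S.carrier) (T : CSet Ξ) (t : T.carrier) (U : CSet Ξ) :
    CIso ((S.ins s T).ins (Sum.inr t) U) (S.ins s (T.ins t U)) where
  toEquiv :=
    { toFun := fun x => match x with
        | Sum.inl ⟨Sum.inl y, _⟩ => Sum.inl y
        | Sum.inl ⟨Sum.inr y, h⟩ => Sum.inr (Sum.inl ⟨y, fun e => h (congrArg Sum.inr e)⟩)
        | Sum.inr y => Sum.inr (Sum.inr y)
      invFun := fun x => match x with
        | Sum.inl y => Sum.inl ⟨Sum.inl y, Sum.inl_ne_inr⟩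
        | Sum.inr (Sum.inl y) => Sum.inl ⟨Sum.inr y.1, fun e => y.2 (Sum.inr_injective e)⟩
        | Sum.inr (Sum.inr y) => Sum.inr y
      left_inv := by rintro (⟨x | x, h⟩ | x) <;> rfl
      right_inv := by rintro (x | x | x) <;> rfl }
  color_eq := by rintro (⟨x | x, h⟩ | x) <;> rfl

/-- Parallel grafting: `(((S ∖ {s}) ⊔ T) ∖ {s'}) ⊔ U ≅ (((S ∖ {s'}) ⊔ U) ∖ {s}) ⊔ T`. -/
def insComm (S : CSet Ξ) (s s' : S.carrier) (hs : s' ≠ s) (T U : CSet Ξ) :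
    CIso ((S.ins s T).ins (Sum.inl ⟨s', hs⟩) U) ((S.ins s' U).ins (Sum.inl ⟨s, hs.symm⟩) T) where
  toEquiv :=
    { toFun := fun x => match x with
        | Sum.inl ⟨Sum.inl y, h⟩ => Sum.inl ⟨Sum.inl ⟨y.1, fun e =>
            h (congrArg Sum.inl (Subtype.ext e))⟩, fun e =>
            y.2 (congrArg Subtype.val (Sum.inl_injective e))⟩
        | Sum.inl ⟨Sum.inr y, _⟩ => Sum.inr y
        | Sum.inr y => Sum.inl ⟨Sum.inr y, Sum.inr_ne_inl⟩
      invFun := fun x => match x with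
        | Sum.inl ⟨Sum.inl y, h⟩ => Sum.inl ⟨Sum.inl ⟨y.1, fun e =>
            h (congrArg Sum.inl (Subtype.ext e))⟩, fun e =>
            y.2 (congrArg Subtype.val (Sum.inl_injective e))⟩
        | Sum.inl ⟨Sum.inr y, _⟩ => Sum.inr y
        | Sum.inr y => Sum.inl ⟨Sum.inr y, Sum.inr_ne_inl⟩
      left_inv := by rintro (⟨x | x, h⟩ | x) <;> rfl
      right_inv := by rintro (⟨x | x, h⟩ | x) <;> rfl }
  color_eq := by rintro (⟨x | x, h⟩ | x) <;> rfl

/-- A subset, with the induced colouring. -/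
def sub (R : CSet Ξ) (T : Set R.carrier) : CSet Ξ := ⟨{x // x ∈ T}, fun x => R.color x.1⟩

/-- `(R ∖ T) ⊔ {*}`, with `*` (written `none`) of colour `η`. -/
def quot (R : CSet Ξ) (T : Set R.carrier) (η : Ξ) : CSet Ξ :=
  ⟨Option {x // x ∉ T}, fun x => x.elim η fun y => R.color y.1⟩

/-- The tree with two vertices and set of leaves `R`, in which the leaves in `T` are attached to
the upper vertex and the inner edge has colour `η`. Up to isomorphism, these are all trees with
set of leaves `R` and two nodal vertices, each of them once. -/
noncomputable def join (R : CSet Ξ) (T : Set R.carrier) (η : Ξ) :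
    CIso ((R.quot T η).ins none (R.sub T)) R where
  toEquiv := Equiv.ofBijective
    (fun x : {x : Option {x // x ∉ T} // x ≠ none} ⊕ {x // x ∈ T} => match x with
      | Sum.inl ⟨some y, _⟩ => y.1
      | Sum.inl ⟨none, h⟩ => absurd rfl h
      | Sum.inr y => y.1) (by
    constructor
    · rintro (⟨_ | ⟨x, hx⟩, h⟩ | ⟨x, hx⟩) (⟨_ | ⟨y, hy⟩, h'⟩ | ⟨y, hy⟩) hxy
      · exact absurd rfl h
      · exact absurd rfl h
      · exact absurd rfl h
      · exact absurd rfl h'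
      · obtain rfl : x = y := hxy
        rfl
      · obtain rfl : x = y := hxy
        exact absurd hy hx
      · exact absurd rfl h'
      · obtain rfl : x = y := hxy
        exact absurd hx hy
      · obtain rfl : x = y := hxy
        rfl
    · intro y
      by_cases hy : y ∈ T
      · exact ⟨Sum.inr ⟨y, hy⟩, rfl⟩
      · exact ⟨Sum.inl ⟨some ⟨y, hy⟩, Option.some_ne_none _⟩, rfl⟩)
  color_eq := by
    rintro (⟨_ | x, h⟩ | x)
    · exact absurd rfl h
    · rfl
    · rfl

end CSet

/-! ## Dg collections, dg operads, dg pseudo-cooperads -/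

/-- A `Ξ`-coloured dg collection: a cochain complex `obj S ξ` for every corolla with (labelled)
inputs `S` and output of colour `ξ`, functorial in colour-preserving bijections of `S`. In
particular `obj S ξ` carries the action of the product of the symmetric groups that permute
inputs of the same colour. -/
structure DGCollection (K : Type u) [Field K] (Ξ : Type w) where
  obj : CSet Ξ → Ξ → Type v
  [addCommGroup : ∀ S ξ, AddCommGroup (obj S ξ)]
  [module : ∀ S ξ, Module K (obj S ξ)]
  gr : ∀ S ξ, ℤ → Submodule K (obj S ξ)
  internal : ∀ S ξ, DirectSum.IsInternal (gr S ξ)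
  d : ∀ S ξ, obj S ξ →ₗ[K] obj S ξ
  d_mem : ∀ S ξ i, ∀ x ∈ gr S ξ i, d S ξ x ∈ gr S ξ (i + 1)
  d_d : ∀ S ξ x, d S ξ (d S ξ x) = 0
  act : ∀ {S T : CSet Ξ} (_ : CIso S T) (ξ : Ξ), obj S ξ →ₗ[K] obj T ξ
  act_refl : ∀ S ξ x, act (CIso.refl S) ξ x = x
  act_trans : ∀ {S T U : CSet Ξ} (e : CIso S T) (e' : CIso T U) ξ x,
    act (e.trans e') ξ x = act e' ξ (act e ξ x)
  act_mem : ∀ {S T : CSet Ξ} (e : CIso S T) ξ i, ∀ x ∈ gr S ξ i, act e ξ x ∈ gr T ξ i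
  act_d : ∀ {S T : CSet Ξ} (e : CIso S T) ξ x, act e ξ (d S ξ x) = d T ξ (act e ξ x)

attribute [instance] DGCollection.addCommGroup DGCollection.module

/-- A `Ξ`-coloured dg operad (symmetric, with units), in terms of the elementary insertions
`a ∘_s b`, where the output colour `η` of `b` is the colour of the input `s` of `a`. -/
structure DGOperad (K : Type u) [Field K] (Ξ : Type w) extends DGCollection.{u, w, v} K Ξ where
  comp : ∀ {S : CSet Ξ} (s : S.carrier) (T : CSet Ξ) {η : Ξ} (_ : S.color s = η) (ξ : Ξ),
    obj S ξ →ₗ[K] obj T η →ₗ[K] obj (S.ins s T) ξ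
  comp_mem : ∀ {S : CSet Ξ} (s : S.carrier) (T : CSet Ξ) {η : Ξ} (h : S.color s = η) (ξ : Ξ)
    (i j : ℤ), ∀ a ∈ gr S ξ i, ∀ b ∈ gr T η j, comp s T h ξ a b ∈ gr (S.ins s T) ξ (i + j)
  comp_d : ∀ {S : CSet Ξ} (s : S.carrier) (T : CSet Ξ) {η : Ξ} (h : S.color s = η) (ξ : Ξ)
    (i : ℤ), ∀ a ∈ gr S ξ i, ∀ b : obj T η, d (S.ins s T) ξ (comp s T h ξ a b) =
      comp s T h ξ (d S ξ a) b + i.negOnePow • comp s T h ξ a (d T η b)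
  comp_act : ∀ {S S' T T' : CSet Ξ} (e : CIso S S') (e' : CIso T T') (s : S.carrier) {η : Ξ}
    (h : S.color s = η) (h' : S'.color (e.toEquiv s) = η) (ξ : Ξ) (a : obj S ξ) (b : obj T η),
    comp (e.toEquiv s) T' h' ξ (act e ξ a) (act e' η b) =
      act (CSet.insMap e s e') ξ (comp s T h ξ a b)
  comp_assoc : ∀ {S T U : CSet Ξ} (s : S.carrier) (t : T.carrier) {η θ : Ξ}
    (h : S.color s = η) (h' : T.color t = θ) (ξ : Ξ)
    (a : obj S ξ) (b : obj T η) (c : obj U θ),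
    act (CSet.insAssoc S s T t U) ξ
        (comp (S := S.ins s T) (Sum.inr t) U h' ξ (comp s T h ξ a b) c) =
      comp s (T.ins t U) h ξ a (comp t U h' η b c)
  comp_comm : ∀ {S T U : CSet Ξ} (s s' : S.carrier) (hs : s' ≠ s) {η θ : Ξ}
    (h : S.color s = η) (h' : S.color s' = θ) (ξ : Ξ) (i j : ℤ)
    (a : obj S ξ), ∀ b ∈ gr T η i, ∀ c ∈ gr U θ j,
    act (CSet.insComm S s s' hs T U) ξ
        (comp (S := S.ins s T) (Sum.inl ⟨s', hs⟩) U h' ξ (comp s T h ξ a b) c) =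
      (i * j).negOnePow •
        comp (S := S.ins s' U) (Sum.inl ⟨s, hs.symm⟩) T h ξ (comp s' U h' ξ a c) b
  unit : ∀ ξ : Ξ, obj (CSet.single ξ) ξ
  unit_mem : ∀ ξ, unit ξ ∈ gr (CSet.single ξ) ξ 0
  d_unit : ∀ ξ, d (CSet.single ξ) ξ (unit ξ) = 0
  comp_unit : ∀ {S : CSet Ξ} (s : S.carrier) {η : Ξ} (h : S.color s = η) (ξ : Ξ) (a : obj S ξ),
    act (CSet.insSingle S s h) ξ (comp s (CSet.single η) h ξ a (unit η)) = a
  unit_comp : ∀ (T : CSet Ξ) (ξ : Ξ) (b : obj T ξ),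
    act (CSet.singleIns ξ T) ξ
      (comp (S := CSet.single ξ) () T (η := ξ) rfl ξ (unit ξ) b) = b

/-- A `Ξ`-coloured dg pseudo-cooperad (no counit): the notion dual to that of a dg operad without
units. `comul s T` is the comultiplication `Δ_t` for the tree `t` with two vertices obtained by
grafting the corolla with inputs `T` into the input `s` of the corolla with inputs `S`; the
comultiplications for larger trees are the iterations of these. -/
structure DGPseudoCooperad (K : Type u) [Field K] (Ξ : Type w) extends
    DGCollection.{u, w, v} K Ξ where
  comul : ∀ {S : CSet Ξ} (s : S.carrier) (T : CSet Ξ) {η : Ξ} (_ : S.color s = η) (ξ : Ξ),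
    obj (S.ins s T) ξ →ₗ[K] obj S ξ ⊗[K] obj T η
  comul_mem : ∀ {S : CSet Ξ} (s : S.carrier) (T : CSet Ξ) {η : Ξ} (h : S.color s = η) (ξ : Ξ)
    (k : ℤ), ∀ x ∈ gr (S.ins s T) ξ k, comul s T h ξ x ∈ tensorSum (gr S ξ) (gr T η) k
  comul_d : ∀ {S : CSet Ξ} (s : S.carrier) (T : CSet Ξ) {η : Ξ} (h : S.color s = η) (ξ : Ξ)
    (x : obj (S.ins s T) ξ), comul s T h ξ (d (S.ins s T) ξ x) =
      TensorProduct.map (d S ξ) LinearMap.id (comul s T h ξ x) +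
      TensorProduct.map (signTwist (gr S ξ) (internal S ξ) 1) (d T η) (comul s T h ξ x)
  comul_act : ∀ {S S' T T' : CSet Ξ} (e : CIso S S') (e' : CIso T T') (s : S.carrier) {η : Ξ}
    (h : S.color s = η) (h' : S'.color (e.toEquiv s) = η) (ξ : Ξ) (x : obj (S.ins s T) ξ),
    comul (e.toEquiv s) T' h' ξ (act (CSet.insMap e s e') ξ x) =
      TensorProduct.map (act e ξ) (act e' η) (comul s T h ξ x)
  comul_assoc : ∀ {S T U : CSet Ξ} (s : S.carrier) (t : T.carrier) {η θ : Ξ}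
    (h : S.color s = η) (h' : T.color t = θ) (ξ : Ξ)
    (x : obj ((S.ins s T).ins (Sum.inr t) U) ξ),
    TensorProduct.map LinearMap.id (comul t U h' η)
        (comul s (T.ins t U) h ξ (act (CSet.insAssoc S s T t U) ξ x)) =
      TensorProduct.assoc K _ _ _ (TensorProduct.map (comul s T h ξ) LinearMap.id
        (comul (S := S.ins s T) (Sum.inr t) U h' ξ x))
  comul_comm : ∀ {S T U : CSet Ξ} (s s' : S.carrier) (hs : s' ≠ s) {η θ : Ξ}
    (h : S.color s = η) (h' : S.color s' = θ) (ξ : Ξ)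
    (x : obj ((S.ins s T).ins (Sum.inl ⟨s', hs⟩) U) ξ),
    TensorProduct.assoc K _ _ _ (TensorProduct.map (comul s' U h' ξ) LinearMap.id
        (comul (S := S.ins s' U) (Sum.inl ⟨s, hs.symm⟩) T h ξ
          (act (CSet.insComm S s s' hs T U) ξ x))) =
      TensorProduct.map LinearMap.id
        (koszulSwap (gr T η) (internal T η) (gr U θ) (internal U θ))
        (TensorProduct.assoc K _ _ _ (TensorProduct.map (comul s T h ξ) LinearMap.id
          (comul (S := S.ins s T) (Sum.inl ⟨s', hs⟩) U h' ξ x)))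
  /-- For each `x`, only finitely many of the `Δ_t x`, for `t` a tree with two vertices and leaves
  `R`, are nonzero. This holds automatically if there are only finitely many colours. -/
  comul_finite : ∀ (R : CSet Ξ) (ξ : Ξ) (x : obj R ξ),
    {p : Set R.carrier × Ξ | comul (S := R.quot p.1 p.2) none (R.sub p.1) (η := p.2) rfl ξ
      (act (R.join p.1 p.2).symm ξ x) ≠ 0}.Finite

/-- Morphisms of dg operads. -/
structure DGOperad.Hom {K : Type u} [Field K] {Ξ : Type w}
    (A : DGOperad.{u, w, v₂} K Ξ) (B : DGOperad.{u, w, v₃} K Ξ) where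
  app : ∀ (S : CSet Ξ) (ξ : Ξ), A.obj S ξ →ₗ[K] B.obj S ξ
  app_mem : ∀ S ξ i, ∀ x ∈ A.gr S ξ i, app S ξ x ∈ B.gr S ξ i
  app_d : ∀ S ξ x, app S ξ (A.d S ξ x) = B.d S ξ (app S ξ x)
  app_act : ∀ {S T : CSet Ξ} (e : CIso S T) ξ x, app T ξ (A.act e ξ x) = B.act e ξ (app S ξ x)
  app_comp : ∀ {S : CSet Ξ} (s : S.carrier) (T : CSet Ξ) {η : Ξ} (h : S.color s = η) (ξ : Ξ)
    (a : A.obj S ξ) (b : A.obj T η), app (S.ins s T) ξ (A.comp s T h ξ a b) =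
      B.comp s T h ξ (app S ξ a) (app T η b)
  app_unit : ∀ ξ, app (CSet.single ξ) ξ (A.unit ξ) = B.unit ξ

/-- A morphism of dg operads is a quasi-isomorphism if it is one on each `A(S; ξ)`. -/
def DGOperad.Hom.IsQuasiIso {K : Type u} [Field K] {Ξ : Type w}
    {A : DGOperad.{u, w, v₂} K Ξ} {B : DGOperad.{u, w, v₃} K Ξ} (f : A.Hom B) : Prop :=
  ∀ (S : CSet Ξ) (ξ : Ξ), ConvOperad.IsQuasiIso (A.gr S ξ) (fun _ => A.d S ξ)
    (B.gr S ξ) (fun _ => B.d S ξ) (f.app S ξ)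

namespace DGPseudoCooperad

variable {K : Type u} [Field K] {Ξ : Type w}

/-- An ascending, exhaustive filtration `0 = F 0 ⊆ F 1 ⊆ ...` of a dg pseudo-cooperad by graded
subcollections, such that the differential lowers the filtration by one and the comultiplications
are compatible with it. -/
structure Filtration (P : DGPseudoCooperad.{u, w, v} K Ξ) where
  F : ℕ → ∀ (S : CSet Ξ) (ξ : Ξ), Submodule K (P.obj S ξ)
  graded : ∀ m S ξ, F m S ξ = ⨆ i, F m S ξ ⊓ P.gr S ξ i
  act_mem : ∀ m {S T : CSet Ξ} (e : CIso S T) ξ, ∀ x ∈ F m S ξ, P.act e ξ x ∈ F m T ξ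
  zero : ∀ S ξ, F 0 S ξ = ⊥
  mono : ∀ m S ξ, F m S ξ ≤ F (m + 1) S ξ
  exhaustive : ∀ S ξ (x : P.obj S ξ), ∃ m, x ∈ F m S ξ
  d_mem : ∀ m S ξ, ∀ x ∈ F (m + 1) S ξ, P.d S ξ x ∈ F m S ξ
  comul_mem : ∀ m {S : CSet Ξ} (s : S.carrier) (T : CSet Ξ) {η : Ξ} (h : S.color s = η) (ξ : Ξ),
    ∀ x ∈ F m (S.ins s T) ξ,
      P.comul s T h ξ x ∈ tensorSum (fun k => F k S ξ) (fun k => F k T η) m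

end DGPseudoCooperad

/-! ## The convolution Lie algebra -/

section Conv

variable {K : Type u} [Field K] {Ξ : Type w}

/-- Arbitrary families of linear maps `P(S; ξ) → O(S; ξ)`. -/
abbrev Families (P : DGPseudoCooperad.{u, w, v₁} K Ξ) (O : DGOperad.{u, w, v} K Ξ) :=
  ∀ (S : CSet Ξ) (ξ : Ξ), P.obj S ξ →ₗ[K] O.obj S ξ

/-- `Conv(P, O)` in degree `p`: the morphisms of collections of degree `p`, that is, the families
of linear maps of degree `p` which commute with colour-preserving bijections. -/
def conv (P : DGPseudoCooperad.{u, w, v₁} K Ξ) (O : DGOperad.{u, w, v} K Ξ) (p : ℤ) :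
    Submodule K (Families P O) where
  carrier := {φ | (∀ S ξ i, ∀ x ∈ P.gr S ξ i, φ S ξ x ∈ O.gr S ξ (i + p)) ∧
    ∀ (S T : CSet Ξ) (e : CIso S T) ξ x, φ T ξ (P.act e ξ x) = O.act e ξ (φ S ξ x)}
  add_mem' := by
    rintro φ ψ ⟨h1, h2⟩ ⟨h3, h4⟩
    exact ⟨fun S ξ i x hx => add_mem (h1 S ξ i x hx) (h3 S ξ i x hx), fun S T e ξ x => by
      simp [h2 S T e ξ x, h4 S T e ξ x]⟩
  zero_mem' := ⟨fun S ξ i x _ => by simp, fun S T e ξ x => by simp⟩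
  smul_mem' := by
    rintro c φ ⟨h1, h2⟩
    exact ⟨fun S ξ i x hx => Submodule.smul_mem _ c (h1 S ξ i x hx), fun S T e ξ x => by
      simp [h2 S T e ξ x]⟩

/-- `F_m Conv(P, O)` in degree `p`: the elements of `Conv(P, O)` of degree `p` that vanish on
`F (m - 1)` (for `m ≥ 1`). -/
def convFil {P : DGPseudoCooperad.{u, w, v₁} K Ξ} (F : P.Filtration) (O : DGOperad.{u, w, v} K Ξ)
    (m : ℕ) (p : ℤ) : Submodule K (Families P O) :=
  conv P O p ⊓
    { carrier := {φ | ∀ S ξ, ∀ x ∈ F.F (m - 1) S ξ, φ S ξ x = 0}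
      add_mem' := by
        intro φ ψ h1 h2 S ξ x hx
        simp [h1 S ξ x hx, h2 S ξ x hx]
      zero_mem' := by
        intro S ξ x hx
        simp
      smul_mem' := by
        intro c φ h1 S ξ x hx
        simp [h1 S ξ x hx] }

/-- The differential `φ ↦ ∂_O ∘ φ - (-1) ^ p φ ∘ ∂_P` on elements `φ` of degree `p`. -/
def convD (P : DGPseudoCooperad.{u, w, v₁} K Ξ) (O : DGOperad.{u, w, v} K Ξ) (p : ℤ) :
    Families P O →ₗ[K] Families P O where
  toFun φ := fun S ξ => O.d S ξ ∘ₗ φ S ξ - p.negOnePow • (φ S ξ ∘ₗ P.d S ξ)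
  map_add' φ ψ := by
    funext S ξ
    ext x
    simp only [Pi.add_apply, LinearMap.sub_apply, LinearMap.comp_apply, LinearMap.add_apply,
      LinearMap.smul_apply, map_add, smul_add]
    abel
  map_smul' c φ := by
    funext S ξ
    ext x
    simp only [Pi.smul_apply, LinearMap.sub_apply, LinearMap.comp_apply, LinearMap.smul_apply,
      map_smul, smul_sub, RingHom.id_apply, smul_comm c p.negOnePow]

/-- The contribution `μ_t ∘ (φ ⊗ ψ) ∘ Δ_t` of the tree `t` with two vertices, given by the subset
`T` of the leaves and the colour `η` of the inner edge. Here `ψ` has degree `q`, and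
`(φ ⊗ ψ)(x ⊗ y) = (-1) ^ (q * |x|) φ(x) ⊗ ψ(y)`. -/
noncomputable def treeTerm (P : DGPseudoCooperad.{u, w, v₁} K Ξ) (O : DGOperad.{u, w, v} K Ξ)
    (q : ℤ) (φ ψ : Families P O) (R : CSet Ξ) (ξ : Ξ) (T : Set R.carrier) (η : Ξ) :
    P.obj R ξ →ₗ[K] O.obj R ξ :=
  O.act (R.join T η) ξ ∘ₗ
    TensorProduct.lift (O.comp (S := R.quot T η) none (R.sub T) (η := η) rfl ξ) ∘ₗ
    TensorProduct.map
      (φ (R.quot T η) ξ ∘ₗ signTwist (P.gr (R.quot T η) ξ) (P.internal (R.quot T η) ξ) q)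
      (ψ (R.sub T) η) ∘ₗ
    P.comul (S := R.quot T η) none (R.sub T) (η := η) rfl ξ ∘ₗ
    P.act (R.join T η).symm ξ

theorem treeTerm_finite (P : DGPseudoCooperad.{u, w, v₁} K Ξ) (O : DGOperad.{u, w, v} K Ξ)
    (q : ℤ) (φ ψ : Families P O) (R : CSet Ξ) (ξ : Ξ) (x : P.obj R ξ) :
    (Function.support fun t : Set R.carrier × Ξ =>
      treeTerm P O q φ ψ R ξ t.1 t.2 x).Finite := by
  refine (P.comul_finite R ξ x).subset fun t ht h0 => ht ?_
  simp only [treeTerm, LinearMap.comp_apply]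
  rw [h0]
  simp

/-- The pre-Lie product `φ • ψ = ∑_t μ_t ∘ (φ ⊗ ψ) ∘ Δ_t` for `ψ` of degree `q`, where the sum is
over the isomorphism classes of trees with two vertices (on each vector it is a finite sum). -/
noncomputable def preLie (P : DGPseudoCooperad.{u, w, v₁} K Ξ) (O : DGOperad.{u, w, v} K Ξ)
    (q : ℤ) (φ ψ : Families P O) : Families P O := fun R ξ =>
  { toFun := fun x => ∑ᶠ t : Set R.carrier × Ξ, treeTerm P O q φ ψ R ξ t.1 t.2 x
    map_add' := fun x y => by
      rw [← finsum_add_distrib (treeTerm_finite P O q φ ψ R ξ x) (treeTerm_finite P O q φ ψ R ξ y)]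
      simp
    map_smul' := fun c x => by
      rw [RingHom.id_apply, smul_finsum' c (treeTerm_finite P O q φ ψ R ξ x)]
      simp }

/-- The Lie bracket `[φ, ψ] = φ • ψ - (-1) ^ (p * q) ψ • φ` of elements `φ`, `ψ` of degrees
`p`, `q`. -/
noncomputable def convBracket (P : DGPseudoCooperad.{u, w, v₁} K Ξ) (O : DGOperad.{u, w, v} K Ξ)
    (p q : ℤ) (φ ψ : Families P O) : Families P O :=
  preLie P O q φ ψ - (p * q).negOnePow • preLie P O p ψ φ

/-- `f_* : Conv(P, A) → Conv(P, B)`, `φ ↦ f ∘ φ`. -/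
def pushforward (P : DGPseudoCooperad.{u, w, v₁} K Ξ) {A : DGOperad.{u, w, v₂} K Ξ}
    {B : DGOperad.{u, w, v₃} K Ξ} (f : A.Hom B) : Families P A →ₗ[K] Families P B where
  toFun φ := fun S ξ => f.app S ξ ∘ₗ φ S ξ
  map_add' φ ψ := by
    funext S ξ
    ext x
    simp
  map_smul' c φ := by
    funext S ξ
    ext x
    simp

end Conv

end ConvOperad

/-! Over a field, every acyclic complex has a contraction, and in characteristic zero the mean of
its conjugates under the finitely many isomorphisms of coloured sets is equivariant. Applied to the
mapping cone of `f`, this yields an equivariant contraction `k` of the collection `cone f`. Since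
the maps of collections `P → cone f` form the mapping cone of `f_*`, postcomposition with `k`
contracts that cone, and it preserves the condition of vanishing on a given subcollection of `P`.
Hence `f_*` is a quasi-isomorphism. A step of the filtration is a graded dg coideal of `P`, so the
bracket and the differential preserve the families that vanish on it. -/

namespace ConvOperad

section GradedModules

variable {R ι M N : Type*} [Ring R] [AddCommGroup M] [Module R M] [AddCommGroup N] [Module R N]

theorem linearMap_ext_of_iSup_eq_top {G : ι → Submodule R M} (hG : ⨆ i, G i = ⊤)
    {f g : M →ₗ[R] N} (h : ∀ i, ∀ x ∈ G i, f x = g x) : f = g := by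
  rw [← LinearMap.eqLocus_eq_top, eq_top_iff, ← hG]
  exact iSup_le h

variable [DecidableEq ι]

theorem exists_linearMap_of_isInternal {G : ι → Submodule R M} (hG : DirectSum.IsInternal G)
    (f : ι → M →ₗ[R] N) : ∃ g : M →ₗ[R] N, ∀ i, ∀ x ∈ G i, g x = f i x := by
  let e := LinearEquiv.ofBijective (DirectSum.coeLinearMap G) hG
  refine ⟨DirectSum.toModule R ι N (fun i => f i ∘ₗ (G i).subtype) ∘ₗ e.symm, fun i x hx => ?_⟩
  have he : e.symm x = DirectSum.lof R ι (fun i => G i) i ⟨x, hx⟩ :=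
    e.symm_apply_eq.2 (DirectSum.coeLinearMap_lof G i ⟨x, hx⟩).symm
  simp [he, DirectSum.toModule_lof]

theorem isInternal_comp_equiv {κ : Type*} [DecidableEq κ] {G : ι → Submodule R M}
    (hG : DirectSum.IsInternal G) (e : κ ≃ ι) : DirectSum.IsInternal fun k => G (e k) := by
  rw [DirectSum.isInternal_submodule_iff_iSupIndep_and_iSup_eq_top] at hG ⊢
  exact ⟨hG.1.comp e.injective, (e.iSup_comp (g := G)).trans hG.2⟩

theorem isInternal_prod {G : ι → Submodule R M} {H : ι → Submodule R N}
    (hG : DirectSum.IsInternal G) (hH : DirectSum.IsInternal H) :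
    DirectSum.IsInternal fun i => (G i).prod (H i) := by
  rw [DirectSum.isInternal_submodule_iff_iSupIndep_and_iSup_eq_top] at hG hH ⊢
  constructor
  · intro i
    have hle : ⨆ (j) (_ : j ≠ i), (G j).prod (H j) ≤
        (⨆ (j) (_ : j ≠ i), G j).prod (⨆ (j) (_ : j ≠ i), H j) :=
      iSup₂_le fun j hj => Submodule.prod_mono
        (le_iSup₂ (f := fun j (_ : j ≠ i) => G j) j hj)
        (le_iSup₂ (f := fun j (_ : j ≠ i) => H j) j hj)
    refine Disjoint.mono_right hle (disjoint_iff.2 ?_)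
    rw [Submodule.prod_inf_prod, (hG.1 i).eq_bot, (hH.1 i).eq_bot, Submodule.prod_bot]
  · have hinl : (⊤ : Submodule R M) ≤
        (⨆ i, (G i).prod (H i)).comap (LinearMap.inl R M N) := by
      rw [← hG.2]
      exact iSup_le fun i x hx => Submodule.mem_iSup_of_mem i ⟨hx, zero_mem _⟩
    have hinr : (⊤ : Submodule R N) ≤
        (⨆ i, (G i).prod (H i)).comap (LinearMap.inr R M N) := by
      rw [← hH.2]
      exact iSup_le fun i y hy => Submodule.mem_iSup_of_mem i ⟨zero_mem _, hy⟩
    refine eq_top_iff.2 fun z _ => ?_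
    rw [← Prod.fst_add_snd z]
    exact add_mem (hinl Submodule.mem_top) (hinr Submodule.mem_top)

end GradedModules

section Signs

variable {K : Type*} [Field K]
variable {M : Type*} [AddCommGroup M] [Module K M] {N : Type*} [AddCommGroup N] [Module K N]

theorem signTwist_mem {G : ℤ → Submodule K M} (hG : DirectSum.IsInternal G) (q i : ℤ) {x : M}
    (hx : x ∈ G i) : signTwist G hG q x ∈ G i := by
  rw [signTwist_of_mem G hG q i hx]
  exact (G i).smul_of_tower_mem _ hx

theorem signTwist_mem_of_le_iSup_inf {G : ℤ → Submodule K M} (hG : DirectSum.IsInternal G) (q : ℤ)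
    {W : Submodule K M} (hW : W ≤ ⨆ i, W ⊓ G i) {x : M} (hx : x ∈ W) :
    signTwist G hG q x ∈ W := by
  have hcomap : ⨆ i, W ⊓ G i ≤ W.comap (signTwist G hG q) := iSup_le fun i y hy => by
    rw [Submodule.mem_comap, signTwist_of_mem G hG q i hy.2]
    exact W.smul_of_tower_mem _ hy.1
  exact hcomap (hW hx)

theorem map_signTwist {G : ℤ → Submodule K M} (hG : DirectSum.IsInternal G)
    {H : ℤ → Submodule K N} (hH : DirectSum.IsInternal H) (q : ℤ) (f : M →ₗ[K] N)
    (hf : ∀ i, ∀ x ∈ G i, f x ∈ H i) (x : M) :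
    f (signTwist G hG q x) = signTwist H hH q (f x) := by
  have h : f ∘ₗ signTwist G hG q = signTwist H hH q ∘ₗ f := by
    refine linearMap_ext_of_iSup_eq_top hG.submodule_iSup_eq_top fun i x hx => ?_
    rw [LinearMap.comp_apply, LinearMap.comp_apply, signTwist_of_mem G hG q i hx,
      signTwist_of_mem H hH q i (hf i x hx), f.map_smul_of_tower]
  exact LinearMap.congr_fun h x

end Signs

section TensorProducts

variable {K : Type*} [Field K]
variable {M : Type*} [AddCommGroup M] [Module K M] {N : Type*} [AddCommGroup N] [Module K N]

theorem tensorSub_mono {G G' : Submodule K M} {H H' : Submodule K N} (hG : G ≤ G') (hH : H ≤ H') :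
    tensorSub G H ≤ tensorSub G' H' :=
  TensorProduct.range_mapIncl_mono hG hH

theorem tensorSub_le_iff {G : Submodule K M} {H : Submodule K N} {W : Submodule K (M ⊗[K] N)} :
    tensorSub G H ≤ W ↔ ∀ a ∈ G, ∀ b ∈ H, a ⊗ₜ b ∈ W := by
  refine ⟨fun h a ha b hb => h ⟨⟨a, ha⟩ ⊗ₜ ⟨b, hb⟩, rfl⟩, ?_⟩
  rintro h _ ⟨z, rfl⟩
  induction z using TensorProduct.induction_on with
  | zero => simp only [map_zero, zero_mem]
  | tmul a b => exact h a a.2 b b.2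
  | add z z' hz hz' => rw [map_add]; exact add_mem hz hz'

theorem tensorSum_le_iff {ι : Type*} [Add ι] {G : ι → Submodule K M} {H : ι → Submodule K N}
    {k : ι} {W : Submodule K (M ⊗[K] N)} :
    tensorSum G H k ≤ W ↔ ∀ i j, i + j = k → ∀ a ∈ G i, ∀ b ∈ H j, a ⊗ₜ b ∈ W := by
  simp only [tensorSum, iSup₂_le_iff, tensorSub_le_iff, Prod.forall]

end TensorProducts

section Cohomology

variable {K : Type*} [Field K]
variable {M : Type*} [AddCommGroup M] [Module K M] {N : Type*} [AddCommGroup N] [Module K N]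
variable {G : ℤ → Submodule K M} {d : ℤ → M →ₗ[K] M}
variable {H : ℤ → Submodule K N} {d' : ℤ → N →ₗ[K] N} {f : M →ₗ[K] N}

theorem mem_cocycles {i : ℤ} {x : M} : x ∈ cocycles G d i ↔ x ∈ G i ∧ d i x = 0 := Iff.rfl

theorem cohomology_mk_eq_zero {i : ℤ} (x : cocycles G d i) :
    (Submodule.Quotient.mk x : Cohomology G d i) = 0 ↔ (x : M) ∈ coboundaries G d i :=
  Submodule.Quotient.mk_eq_zero _

theorem cohomology_mk_eq_mk {i : ℤ} (x y : cocycles G d i) :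
    (Submodule.Quotient.mk x : Cohomology G d i) = Submodule.Quotient.mk y ↔
      (x - y : M) ∈ coboundaries G d i :=
  Submodule.Quotient.eq _

theorem injective_cohomologyMap_iff (hf : IsCochainMap G d H d' f) (i : ℤ) :
    Function.Injective (cohomologyMap hf i) ↔
      ∀ a ∈ cocycles G d i, f a ∈ coboundaries H d' i → a ∈ coboundaries G d i := by
  rw [injective_iff_map_eq_zero]
  refine ⟨fun h a ha hfa => ?_, fun h ω hω => ?_⟩
  · exact (cohomology_mk_eq_zero ⟨a, ha⟩).1
      (h (Submodule.Quotient.mk ⟨a, ha⟩) ((cohomology_mk_eq_zero _).2 hfa))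
  · obtain ⟨a, rfl⟩ := Submodule.Quotient.mk_surjective _ ω
    exact (cohomology_mk_eq_zero a).2 (h a a.2 ((cohomology_mk_eq_zero _).1 hω))

theorem surjective_cohomologyMap_iff (hf : IsCochainMap G d H d' f) (i : ℤ) :
    Function.Surjective (cohomologyMap hf i) ↔
      ∀ b ∈ cocycles H d' i, ∃ a ∈ cocycles G d i, b - f a ∈ coboundaries H d' i := by
  refine ⟨fun h b hb => ?_, fun h ω => ?_⟩
  · obtain ⟨ω, hω⟩ := h (Submodule.Quotient.mk ⟨b, hb⟩)
    obtain ⟨a, rfl⟩ := Submodule.Quotient.mk_surjective _ ω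
    exact ⟨a, a.2, (cohomology_mk_eq_mk ⟨b, hb⟩ _).1 hω.symm⟩
  · obtain ⟨b, rfl⟩ := Submodule.Quotient.mk_surjective _ ω
    obtain ⟨a, ha, hab⟩ := h b b.2
    exact ⟨Submodule.Quotient.mk ⟨a, ha⟩, ((cohomology_mk_eq_mk b _).2 hab).symm⟩

/-- Exactness of the complex `(G, d)` in every degree. -/
def IsAcyclic (G : ℤ → Submodule K M) (d : ℤ → M →ₗ[K] M) : Prop :=
  ∀ i, cocycles G d i ≤ coboundaries G d i

theorem IsAcyclic.of_linearEquiv (e : M ≃ₗ[K] N) (he : ∀ i x, e x ∈ H i ↔ x ∈ G i)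
    (hed : ∀ i x, e (d i x) = d' i (e x)) (h : IsAcyclic H d') : IsAcyclic G d := by
  rintro i x ⟨hx, hdx⟩
  obtain ⟨y, hy, hyx⟩ := h i (mem_cocycles.2 ⟨(he i x).2 hx, by
    rw [← hed, LinearMap.mem_ker.1 hdx, map_zero]⟩)
  refine ⟨e.symm y, (he _ _).1 (by rwa [e.apply_symm_apply]), e.injective ?_⟩
  rw [hed, e.apply_symm_apply, hyx]

/-- The graded vector space underlying the mapping cone of a cochain map from a complex graded by
`G` to one graded by `H`. -/
def coneGr (G : ℤ → Submodule K M) (H : ℤ → Submodule K N) (i : ℤ) : Submodule K (M × N) :=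
  (G (i + 1)).prod (H i)

/-- The differential `(a, b) ↦ (-d a, f a + d' b)` of the mapping cone of `f`. -/
def coneD (d : ℤ → M →ₗ[K] M) (d' : ℤ → N →ₗ[K] N) (f : M →ₗ[K] N) (i : ℤ) :
    M × N →ₗ[K] M × N :=
  (-(d (i + 1) ∘ₗ LinearMap.fst K M N)).prod
    (f ∘ₗ LinearMap.fst K M N + d' i ∘ₗ LinearMap.snd K M N)

theorem isInternal_coneGr (hG : DirectSum.IsInternal G) (hH : DirectSum.IsInternal H) :
    DirectSum.IsInternal (coneGr G H) :=
  isInternal_prod (isInternal_comp_equiv hG (Equiv.addRight 1)) hH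

theorem mem_cocycles_cone {i : ℤ} {a : M} {b : N} :
    (a, b) ∈ cocycles (coneGr G H) (coneD d d' f) i ↔
      a ∈ cocycles G d (i + 1) ∧ b ∈ H i ∧ f a + d' i b = 0 := by
  simp only [cocycles, coneGr, coneD, Submodule.mem_inf, Submodule.mem_prod, LinearMap.mem_ker,
    LinearMap.prod_apply, Function.prod_apply, Prod.mk_eq_zero, LinearMap.neg_apply, neg_eq_zero,
    LinearMap.comp_apply, LinearMap.add_apply, LinearMap.fst_apply, LinearMap.snd_apply]
  tauto

theorem mem_coboundaries_cone {i : ℤ} {a : M} {b : N} :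
    (a, b) ∈ coboundaries (coneGr G H) (coneD d d' f) i ↔
      ∃ a' ∈ G i, ∃ b' ∈ H (i - 1), -d i a' = a ∧ f a' + d' (i - 1) b' = b := by
  simp only [coboundaries, coneGr, coneD, sub_add_cancel, Submodule.mem_map, Submodule.mem_prod,
    Prod.exists, LinearMap.prod_apply, Function.prod_apply, Prod.mk.injEq, LinearMap.neg_apply,
    LinearMap.comp_apply, LinearMap.add_apply, LinearMap.fst_apply, LinearMap.snd_apply]
  exact ⟨fun ⟨a', b', ⟨ha', hb'⟩, h⟩ => ⟨a', ha', b', hb', h⟩,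
    fun ⟨a', ha', b', hb', h⟩ => ⟨a', b', ⟨ha', hb'⟩, h⟩⟩

theorem isAcyclic_cone_of_bijective (hf : IsCochainMap G d H d' f)
    (h : ∀ i, Function.Bijective (cohomologyMap hf i)) :
    IsAcyclic (coneGr G H) (coneD d d' f) := by
  rintro i ⟨a, b⟩ hab
  obtain ⟨ha, hb, hfab⟩ := mem_cocycles_cone.1 hab
  obtain ⟨a', ha', rfl⟩ : ∃ a' ∈ G i, d i a' = a := by
    have hfa : f a ∈ coboundaries H d' (i + 1) := by
      rw [eq_neg_of_add_eq_zero_left hfab]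
      refine neg_mem ⟨b, ?_, ?_⟩
      · simpa only [add_sub_cancel_right, SetLike.mem_coe] using hb
      · simp only [add_sub_cancel_right]
    have hbdry := (injective_cohomologyMap_iff hf (i + 1)).1 (h (i + 1)).1 a ha hfa
    simpa only [coboundaries, add_sub_cancel_right, Submodule.mem_map] using hbdry
  have hb' : b + f a' ∈ cocycles H d' i := by
    refine mem_cocycles.2 ⟨add_mem hb (hf.map_mem i a' ha'), ?_⟩
    rw [map_add, ← hf.comm i a' ha', add_comm, hfab]
  obtain ⟨c, hc, b', hb', hbc⟩ := (surjective_cohomologyMap_iff hf i).1 (h i).2 _ hb'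
  refine mem_coboundaries_cone.2 ⟨c - a', sub_mem hc.1 ha', b', hb', ?_, ?_⟩
  · rw [map_sub, LinearMap.mem_ker.1 hc.2, zero_sub, neg_neg]
  · rw [hbc, map_sub]
    abel

theorem bijective_of_isAcyclic_cone (hf : IsCochainMap G d H d' f)
    (h : IsAcyclic (coneGr G H) (coneD d d' f)) (i : ℤ) :
    Function.Bijective (cohomologyMap hf i) := by
  constructor
  · refine (injective_cohomologyMap_iff hf i).2 ?_
    rintro a ha ⟨b, hb, hba⟩
    obtain ⟨a', ha', -, -, haa', -⟩ := mem_coboundaries_cone.1 (h (i - 1)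
      (mem_cocycles_cone (a := a) (b := -b).2 ⟨by rwa [sub_add_cancel], neg_mem hb, by
        rw [map_neg, hba, add_neg_cancel]⟩))
    exact ⟨-a', neg_mem ha', by rw [map_neg, haa']⟩
  · refine (surjective_cohomologyMap_iff hf i).2 fun b hb => ?_
    obtain ⟨a, ha, b', hb', hda, hab⟩ := mem_coboundaries_cone.1 (h i
      (mem_cocycles_cone (a := 0) (b := b).2 ⟨zero_mem _, hb.1, by
        rw [map_zero, LinearMap.mem_ker.1 hb.2, add_zero]⟩))
    exact ⟨a, ⟨ha, neg_eq_zero.1 hda⟩, b', hb', eq_sub_of_add_eq' hab⟩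

end Cohomology

section Contractions

theorem exists_generalizedInverse {K M N : Type*} [DivisionRing K] [AddCommGroup M] [Module K M]
    [AddCommGroup N] [Module K N] (f : M →ₗ[K] N) : ∃ s : N →ₗ[K] M, ∀ x, f (s (f x)) = f x := by
  obtain ⟨g, hg⟩ := f.rangeRestrict.exists_rightInverse_of_surjective f.range_rangeRestrict
  obtain ⟨s, hs⟩ := g.exists_extend
  refine ⟨s, fun x => ?_⟩
  have hsx : s (f x) = g (f.rangeRestrict x) := LinearMap.congr_fun hs (f.rangeRestrict x)
  rw [hsx]
  exact congrArg Subtype.val (LinearMap.congr_fun hg (f.rangeRestrict x))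

variable {K M : Type*} [Field K] [AddCommGroup M] [Module K M] {G : ℤ → Submodule K M}

theorem IsAcyclic.exists_contraction {d : ℤ → M →ₗ[K] M} (h : IsAcyclic G d)
    (hd : IsComplex G d) :
    ∃ k : ℤ → M →ₗ[K] M, (∀ i x, k i x ∈ G (i - 1)) ∧
      ∀ i, ∀ x ∈ G i, d (i - 1) (k i x) + k (i + 1) (d i x) = x := by
  choose s hs using fun i => exists_generalizedInverse (d (i - 1) ∘ₗ (G (i - 1)).subtype)
  let r (i : ℤ) : M →ₗ[K] M := (G (i - 1)).subtype ∘ₗ s i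
  have hr_mem (i : ℤ) (x : M) : r i x ∈ G (i - 1) := (s i x).2
  have hr (i : ℤ) : ∀ y ∈ G (i - 1), d (i - 1) (r i (d (i - 1) y)) = d (i - 1) y :=
    fun y hy => hs i ⟨y, hy⟩
  refine ⟨fun i => r i - r i ∘ₗ r (i + 1) ∘ₗ d i,
    fun i x => sub_mem (hr_mem _ _) (hr_mem _ _), fun i x hx => ?_⟩
  have hcocycle : x - r (i + 1) (d i x) ∈ cocycles G d i := by
    have hmem := hr_mem (i + 1) (d i x)
    have hdr := hr (i + 1) x
    rw [add_sub_cancel_right] at hmem hdr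
    exact mem_cocycles.2 ⟨sub_mem hx hmem, by rw [map_sub, hdr hx, sub_self]⟩
  obtain ⟨y, hy, hyx⟩ := h i hcocycle
  have hdr : d (i - 1) (r i (x - r (i + 1) (d i x))) = x - r (i + 1) (d i x) := by
    rw [← hyx, hr i y hy]
  simp only [LinearMap.sub_apply, LinearMap.comp_apply, hd.d_d i x hx, map_zero, sub_zero]
  rw [← map_sub, hdr, sub_add_cancel]

theorem IsAcyclic.exists_contraction_of_isInternal {d : M →ₗ[K] M}
    (h : IsAcyclic G fun _ => d) (hd : IsComplex G fun _ => d) (hG : DirectSum.IsInternal G) :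
    ∃ k : M →ₗ[K] M, (∀ i, ∀ x ∈ G i, k x ∈ G (i - 1)) ∧ ∀ x, d (k x) + k (d x) = x := by
  obtain ⟨k, hk_mem, hk⟩ := h.exists_contraction hd
  obtain ⟨l, hl⟩ := exists_linearMap_of_isInternal hG k
  refine ⟨l, fun i x hx => hl i x hx ▸ hk_mem i x, fun x => ?_⟩
  have hdl : d ∘ₗ l + l ∘ₗ d = LinearMap.id := by
    refine linearMap_ext_of_iSup_eq_top hG.submodule_iSup_eq_top fun i y hy => ?_
    rw [LinearMap.add_apply, LinearMap.comp_apply, LinearMap.comp_apply, hl i y hy,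
      hl (i + 1) (d y) (hd.d_mem i y hy), hk i y hy, LinearMap.id_apply]
  exact LinearMap.congr_fun hdl x

end Contractions

namespace CIso

variable {Ξ : Type*} {S T U : CSet Ξ}

@[ext]
theorem ext {e e' : CIso S T} (h : ∀ s, e.toEquiv s = e'.toEquiv s) : e = e' := by
  cases e
  cases e'
  congr
  exact Equiv.ext h

theorem symm_trans_self (e : CIso S T) : e.symm.trans e = refl T :=
  ext fun t => e.toEquiv.apply_symm_apply t

theorem self_trans_symm (e : CIso S T) : e.trans e.symm = refl S :=
  ext fun s => e.toEquiv.symm_apply_apply s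

noncomputable instance : Fintype (CIso S T) :=
  have := Finite.of_injective (β := S.carrier ≃ T.carrier) CIso.toEquiv
    fun e e' h => ext fun s => by rw [h]
  Fintype.ofFinite _

/-- Precomposition with an isomorphism, used to reindex sums over all isomorphisms. -/
def precomp (g : CIso S T) (U : CSet Ξ) : CIso T U ≃ CIso S U where
  toFun e := g.trans e
  invFun e := g.symm.trans e
  left_inv e := ext fun t => congrArg e.toEquiv (g.toEquiv.apply_symm_apply t)
  right_inv e := ext fun s => congrArg e.toEquiv (g.toEquiv.symm_apply_apply s)

/-- The isomorphism induced between the inputs of the upper vertices of corresponding trees. -/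
def subMap (e : CIso S T) (X : Set T.carrier) : CIso (S.sub (e.toEquiv ⁻¹' X)) (T.sub X) where
  toEquiv := e.toEquiv.subtypeEquiv fun _ => Iff.rfl
  color_eq s := e.color_eq s.1

/-- The isomorphism induced between the inputs of the lower vertices of corresponding trees. -/
def quotMap (e : CIso S T) (X : Set T.carrier) (η : Ξ) :
    CIso (S.quot (e.toEquiv ⁻¹' X) η) (T.quot X η) where
  toEquiv := Equiv.optionCongr (e.toEquiv.subtypeEquiv fun _ => Iff.rfl)
  color_eq s := by
    rcases s with _ | s
    · rfl
    · exact e.color_eq s.1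

theorem insMap_trans_join (e : CIso S T) (X : Set T.carrier) (η : Ξ) :
    (CSet.insMap (e.quotMap X η) none (e.subMap X)).trans (T.join X η) =
      (S.join (e.toEquiv ⁻¹' X) η).trans e := by
  refine ext ?_
  rintro (⟨_ | x, h⟩ | x)
  · exact absurd rfl h
  · rfl
  · rfl

end CIso

namespace CSet

variable {Ξ : Type*}

/-- The isomorphism relation on coloured finite sets. -/
def isoSetoid (Ξ : Type*) : Setoid (CSet Ξ) where
  r S T := Nonempty (CIso S T)
  iseqv := ⟨fun S => ⟨CIso.refl S⟩, fun ⟨e⟩ => ⟨e.symm⟩, fun ⟨e₁⟩ ⟨e₂⟩ => ⟨e₁.trans e₂⟩⟩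

/-- A chosen representative of the isomorphism class of a coloured finite set. -/
noncomputable def rep (S : CSet Ξ) : CSet Ξ := (Quotient.mk (isoSetoid Ξ) S).out

theorem rep_eq {S T : CSet Ξ} (e : CIso S T) : S.rep = T.rep :=
  congrArg Quotient.out (Quotient.sound (s := isoSetoid Ξ) ⟨e⟩)

instance (S : CSet Ξ) : Nonempty (CIso S S.rep) :=
  (isoSetoid Ξ).symm (Quotient.exact (Quotient.out_eq (Quotient.mk (isoSetoid Ξ) S)))

end CSet

namespace DGCollection

variable {K : Type*} [Field K] {Ξ : Type*} (C : DGCollection K Ξ)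

theorem act_act_symm {S T : CSet Ξ} (e : CIso S T) (ξ : Ξ) (x : C.obj T ξ) :
    C.act e ξ (C.act e.symm ξ x) = x := by
  rw [← C.act_trans, e.symm_trans_self, C.act_refl]

theorem act_symm_act {S T : CSet Ξ} (e : CIso S T) (ξ : Ξ) (x : C.obj S ξ) :
    C.act e.symm ξ (C.act e ξ x) = x := by
  rw [← C.act_trans, e.self_trans_symm, C.act_refl]

/-- The mean over all isomorphisms `e : S ≅ R` of the conjugates `e⁻¹ ∘ θ ∘ e` of an endomorphism
`θ` of `C(R; ξ)`. It is defined for all `S` at once, so as to be natural in `S`, and it is zero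
when `S` and `R` are not isomorphic. -/
noncomputable def isoAverage {R : CSet Ξ} {ξ : Ξ} (θ : C.obj R ξ →ₗ[K] C.obj R ξ) (S : CSet Ξ) :
    C.obj S ξ →ₗ[K] C.obj S ξ :=
  (Fintype.card (CIso S R) : K)⁻¹ • ∑ e : CIso S R, C.act e.symm ξ ∘ₗ θ ∘ₗ C.act e ξ

variable {C} {R : CSet Ξ} {ξ : Ξ} {θ : C.obj R ξ →ₗ[K] C.obj R ξ}

theorem isoAverage_apply (S : CSet Ξ) (x : C.obj S ξ) :
    C.isoAverage θ S x = (Fintype.card (CIso S R) : K)⁻¹ •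
      ∑ e : CIso S R, C.act e.symm ξ (θ (C.act e ξ x)) := by
  simp only [isoAverage, LinearMap.smul_apply, LinearMap.sum_apply, LinearMap.comp_apply]

theorem isoAverage_act {S T : CSet Ξ} (g : CIso S T) (x : C.obj S ξ) :
    C.isoAverage θ T (C.act g ξ x) = C.act g ξ (C.isoAverage θ S x) := by
  have hterm (e : CIso T R) : C.act e.symm ξ (θ (C.act e ξ (C.act g ξ x))) =
      C.act g ξ (C.act (g.trans e).symm ξ (θ (C.act (g.trans e) ξ x))) := by
    have hsymm : (g.trans e).symm = e.symm.trans g.symm := rfl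
    rw [hsymm, C.act_trans e.symm, C.act_act_symm, C.act_trans g]
  rw [isoAverage_apply, isoAverage_apply, map_smul, map_sum,
    Finset.sum_congr rfl fun e _ => hterm e, Fintype.card_congr (g.precomp R)]
  congr 1
  exact Fintype.sum_equiv (g.precomp R) _ _ fun e => rfl

theorem isoAverage_mem {p : ℤ} (hθ : ∀ i, ∀ x ∈ C.gr R ξ i, θ x ∈ C.gr R ξ (i + p)) (S : CSet Ξ)
    {i : ℤ} {x : C.obj S ξ} (hx : x ∈ C.gr S ξ i) : C.isoAverage θ S x ∈ C.gr S ξ (i + p) := by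
  rw [isoAverage_apply]
  exact Submodule.smul_mem _ _ (sum_mem fun e _ =>
    C.act_mem e.symm ξ _ _ (hθ i _ (C.act_mem e ξ i x hx)))

theorem d_isoAverage_add_isoAverage_d [CharZero K]
    (hθ : ∀ x, C.d R ξ (θ x) + θ (C.d R ξ x) = x) (S : CSet Ξ) [Nonempty (CIso S R)]
    (x : C.obj S ξ) : C.d S ξ (C.isoAverage θ S x) + C.isoAverage θ S (C.d S ξ x) = x := by
  have hterm (e : CIso S R) : C.d S ξ (C.act e.symm ξ (θ (C.act e ξ x))) +
      C.act e.symm ξ (θ (C.act e ξ (C.d S ξ x))) = x := by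
    rw [← C.act_d, C.act_d e, ← map_add, hθ, C.act_symm_act]
  rw [isoAverage_apply, isoAverage_apply, map_smul, map_sum, ← smul_add, ← Finset.sum_add_distrib,
    Finset.sum_congr rfl fun e _ => hterm e, Finset.sum_const, Finset.card_univ,
    ← Nat.cast_smul_eq_nsmul K, inv_smul_smul₀ (Nat.cast_ne_zero.2 Fintype.card_ne_zero)]

variable (C) in
/-- A contracting homotopy of `C` that is natural in colour-preserving bijections. -/
structure Contraction where
  h : ∀ S ξ, C.obj S ξ →ₗ[K] C.obj S ξ
  h_mem : ∀ S ξ i, ∀ x ∈ C.gr S ξ i, h S ξ x ∈ C.gr S ξ (i - 1)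
  h_act : ∀ {S T : CSet Ξ} (g : CIso S T) ξ x, h T ξ (C.act g ξ x) = C.act g ξ (h S ξ x)
  d_h_add_h_d : ∀ S ξ x, C.d S ξ (h S ξ x) + h S ξ (C.d S ξ x) = x

variable (C) in
theorem isComplex (S : CSet Ξ) (ξ : Ξ) : IsComplex (C.gr S ξ) fun _ => C.d S ξ :=
  ⟨C.d_mem S ξ, fun _ x _ => C.d_d S ξ x⟩

theorem nonempty_contraction [CharZero K]
    (hC : ∀ S ξ, IsAcyclic (C.gr S ξ) fun _ => C.d S ξ) : Nonempty C.Contraction := by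
  choose k hk_mem hk using fun S ξ =>
    (hC S ξ).exists_contraction_of_isInternal (C.isComplex S ξ) (C.internal S ξ)
  refine ⟨⟨fun S ξ => C.isoAverage (k S.rep ξ) S, fun S ξ i x hx => ?_, fun {S T} g ξ x => ?_,
    fun S ξ => d_isoAverage_add_isoAverage_d (hk S.rep ξ) S⟩⟩
  · exact isoAverage_mem (p := -1) (hk_mem S.rep ξ) S hx
  · rw [CSet.rep_eq g]
    exact isoAverage_act g x

end DGCollection

section HomComplex

variable {K : Type*} [Field K] {Ξ : Type*}

/-- Families of linear maps `C(S; ξ) → D(S; ξ)`; for the underlying collections of `P` and `O` these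
are `Families P O`. -/
abbrev HomFamily (C D : DGCollection K Ξ) :=
  ∀ (S : CSet Ξ) (ξ : Ξ), C.obj S ξ →ₗ[K] D.obj S ξ

variable {C : DGCollection K Ξ} (V : ∀ S ξ, Submodule K (C.obj S ξ)) (D : DGCollection K Ξ)

/-- The morphisms of collections `C → D` of degree `p` that vanish on `V`. For `V = F (m - 1)` this
is `convFil F O m p`. -/
def homVanishing (p : ℤ) : Submodule K (HomFamily C D) where
  carrier := {φ | ((∀ S ξ i, ∀ x ∈ C.gr S ξ i, φ S ξ x ∈ D.gr S ξ (i + p)) ∧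
    ∀ (S T : CSet Ξ) (e : CIso S T) ξ x, φ T ξ (C.act e ξ x) = D.act e ξ (φ S ξ x)) ∧
    ∀ S ξ, ∀ x ∈ V S ξ, φ S ξ x = 0}
  add_mem' := by
    rintro φ ψ ⟨⟨hφ, hφ'⟩, hφV⟩ ⟨⟨hψ, hψ'⟩, hψV⟩
    exact ⟨⟨fun S ξ i x hx => add_mem (hφ S ξ i x hx) (hψ S ξ i x hx), fun S T e ξ x => by
      simp only [Pi.add_apply, LinearMap.add_apply, hφ', hψ', map_add]⟩, fun S ξ x hx => by
      simp only [Pi.add_apply, LinearMap.add_apply, hφV S ξ x hx, hψV S ξ x hx, add_zero]⟩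
  zero_mem' := ⟨⟨fun _ _ _ _ _ => zero_mem _, fun _ _ e ξ _ => (map_zero (D.act e ξ)).symm⟩,
    fun _ _ _ _ => rfl⟩
  smul_mem' := by
    rintro c φ ⟨⟨hφ, hφ'⟩, hφV⟩
    exact ⟨⟨fun S ξ i x hx => Submodule.smul_mem _ c (hφ S ξ i x hx), fun S T e ξ x => by
      simp only [Pi.smul_apply, LinearMap.smul_apply, hφ', map_smul]⟩, fun S ξ x hx => by
      simp only [Pi.smul_apply, LinearMap.smul_apply, hφV S ξ x hx, smul_zero]⟩

variable (C) in
/-- The differential `φ ↦ ∂_D ∘ φ - (-1) ^ p φ ∘ ∂_C` on families `φ` of degree `p`. For the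
underlying collections of `P` and `O` this is `convD P O p`. -/
def homD (p : ℤ) : HomFamily C D →ₗ[K] HomFamily C D where
  toFun φ := fun S ξ => D.d S ξ ∘ₗ φ S ξ - p.negOnePow • (φ S ξ ∘ₗ C.d S ξ)
  map_add' φ ψ := by
    funext S ξ
    ext x
    simp only [Pi.add_apply, LinearMap.sub_apply, LinearMap.comp_apply, LinearMap.add_apply,
      LinearMap.smul_apply, map_add, smul_add]
    abel
  map_smul' c φ := by
    funext S ξ
    ext x
    simp only [Pi.smul_apply, LinearMap.sub_apply, LinearMap.comp_apply, LinearMap.smul_apply,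
      map_smul, smul_sub, RingHom.id_apply, smul_comm c p.negOnePow]

variable {D}

theorem homD_apply (p : ℤ) (φ : HomFamily C D) (S : CSet Ξ) (ξ : Ξ) (x : C.obj S ξ) :
    homD C D p φ S ξ x = D.d S ξ (φ S ξ x) - p.negOnePow • φ S ξ (C.d S ξ x) := rfl

theorem homD_homD (p : ℤ) (φ : HomFamily C D) : homD C D (p + 1) (homD C D p φ) = 0 := by
  funext S ξ
  ext x
  simp only [homD_apply, C.d_d, D.d_d, Int.negOnePow_succ, map_sub, map_zero, smul_zero, sub_zero,
    zero_sub, LinearMap.map_smul_of_tower, Units.neg_smul, sub_neg_eq_add, neg_add_cancel,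
    Pi.zero_apply, LinearMap.zero_apply]

variable {V}

theorem homD_mem (hV : ∀ S ξ, ∀ x ∈ V S ξ, C.d S ξ x ∈ V S ξ) {p : ℤ} {φ : HomFamily C D}
    (hφ : φ ∈ homVanishing V D p) : homD C D p φ ∈ homVanishing V D (p + 1) := by
  obtain ⟨⟨hdeg, hact⟩, hvan⟩ := hφ
  refine ⟨⟨fun S ξ i x hx => ?_, fun S T e ξ x => ?_⟩, fun S ξ x hx => ?_⟩
  · have hdφ := D.d_mem _ _ _ _ (hdeg S ξ i x hx)
    have hφd := hdeg S ξ _ _ (C.d_mem S ξ i x hx)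
    rw [add_assoc] at hdφ
    rw [add_right_comm, add_assoc] at hφd
    rw [homD_apply]
    exact sub_mem hdφ (Submodule.smul_of_tower_mem _ _ hφd)
  · rw [homD_apply, homD_apply, hact, ← D.act_d, ← C.act_d, hact, map_sub,
      LinearMap.map_smul_of_tower]
  · rw [homD_apply, hvan S ξ x hx, hvan S ξ _ (hV S ξ x hx), map_zero, smul_zero, sub_zero]

theorem isComplex_homVanishing (hV : ∀ S ξ, ∀ x ∈ V S ξ, C.d S ξ x ∈ V S ξ) :
    IsComplex (homVanishing V D) (homD C D) :=
  ⟨fun _ _ => homD_mem hV, fun p φ _ => homD_homD p φ⟩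

theorem DGCollection.Contraction.isAcyclic_homVanishing (k : D.Contraction) :
    IsAcyclic (homVanishing V D) (homD C D) := by
  rintro p φ ⟨⟨⟨hdeg, hact⟩, hvan⟩, hdφ⟩
  refine ⟨fun S ξ => k.h S ξ ∘ₗ φ S ξ,
    ⟨⟨fun S ξ i x hx => ?_, fun S T e ξ x => ?_⟩, fun S ξ x hx => ?_⟩, ?_⟩
  · simpa only [add_sub_assoc, LinearMap.comp_apply] using k.h_mem S ξ _ _ (hdeg S ξ i x hx)
  · rw [LinearMap.comp_apply, hact, k.h_act, LinearMap.comp_apply]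
  · rw [LinearMap.comp_apply, hvan S ξ x hx, map_zero]
  · funext S ξ
    ext x
    have hcomm : D.d S ξ (φ S ξ x) = p.negOnePow • φ S ξ (C.d S ξ x) :=
      sub_eq_zero.1 (LinearMap.congr_fun (congrFun (congrFun hdφ S) ξ) x)
    have hpred : (p - 1).negOnePow = -p.negOnePow := by
      rw [Int.negOnePow_sub, Int.negOnePow_one, mul_neg_one]
    rw [homD_apply, LinearMap.comp_apply, LinearMap.comp_apply, hpred, Units.neg_smul,
      sub_neg_eq_add, ← LinearMap.map_smul_of_tower, ← hcomm, k.d_h_add_h_d]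

end HomComplex

section Pushforward

variable {K : Type*} [Field K] {Ξ : Type*} {A B : DGOperad K Ξ}

/-- The mapping cones of the maps `f : A(S; ξ) → B(S; ξ)`, as a dg collection. -/
def DGOperad.Hom.cone (f : A.Hom B) : DGCollection K Ξ where
  obj S ξ := A.obj S ξ × B.obj S ξ
  gr S ξ := coneGr (A.gr S ξ) (B.gr S ξ)
  internal S ξ := isInternal_coneGr (A.internal S ξ) (B.internal S ξ)
  d S ξ := coneD (fun _ => A.d S ξ) (fun _ => B.d S ξ) (f.app S ξ) 0
  d_mem S ξ i x hx := ⟨neg_mem (A.d_mem S ξ _ _ hx.1),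
    add_mem (f.app_mem S ξ _ _ hx.1) (B.d_mem S ξ _ _ hx.2)⟩
  d_d S ξ x := by
    refine Prod.ext ?_ ?_
    · change -A.d S ξ (-A.d S ξ x.1) = 0
      rw [map_neg, A.d_d, neg_zero, neg_zero]
    · change f.app S ξ (-A.d S ξ x.1) + B.d S ξ (f.app S ξ x.1 + B.d S ξ x.2) = 0
      rw [map_neg, f.app_d, map_add, B.d_d, add_zero, neg_add_cancel]
  act e ξ := (A.act e ξ).prodMap (B.act e ξ)
  act_refl S ξ x := Prod.ext (A.act_refl S ξ x.1) (B.act_refl S ξ x.2)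
  act_trans e e' ξ x := Prod.ext (A.act_trans e e' ξ x.1) (B.act_trans e e' ξ x.2)
  act_mem e ξ i x hx := ⟨A.act_mem e ξ _ _ hx.1, B.act_mem e ξ _ _ hx.2⟩
  act_d {S T} e ξ x := by
    refine Prod.ext ?_ ?_
    · change A.act e ξ (-A.d S ξ x.1) = -A.d T ξ (A.act e ξ x.1)
      rw [map_neg, A.act_d]
    · change B.act e ξ (f.app S ξ x.1 + B.d S ξ x.2) =
        f.app T ξ (A.act e ξ x.1) + B.d T ξ (B.act e ξ x.2)
      rw [map_add, f.app_act, B.act_d]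

theorem DGOperad.Hom.IsQuasiIso.nonempty_contraction_cone [CharZero K] {f : A.Hom B}
    (hf : f.IsQuasiIso) : Nonempty f.cone.Contraction := by
  refine DGCollection.nonempty_contraction fun S ξ => ?_
  obtain ⟨-, -, hfS, hbij⟩ := hf S ξ
  exact (isAcyclic_cone_of_bijective hfS hbij :)

variable {P : DGPseudoCooperad K Ξ} {V : ∀ S ξ, Submodule K (P.obj S ξ)} (f : A.Hom B)

/-- A pair of families of maps to `A` and to `B` is a family of maps to the cone of `f`. -/
def pairEquivConeFamily :
    (Families P A × Families P B) ≃ₗ[K] HomFamily P.toDGCollection f.cone where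
  toFun z S ξ := (z.1 S ξ).prod (z.2 S ξ)
  invFun χ := (fun S ξ => LinearMap.fst K _ _ ∘ₗ χ S ξ, fun S ξ => LinearMap.snd K _ _ ∘ₗ χ S ξ)
  map_add' _ _ := rfl
  map_smul' _ _ := rfl
  left_inv _ := rfl
  right_inv _ := rfl

theorem pairEquivConeFamily_mem_iff (p : ℤ) (z : Families P A × Families P B) :
    pairEquivConeFamily f z ∈ homVanishing V f.cone p ↔
      z ∈ coneGr (homVanishing V A.toDGCollection) (homVanishing V B.toDGCollection) p := by
  have hdeg (i : ℤ) : i + p + 1 = i + (p + 1) := add_assoc i p 1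
  constructor
  · rintro ⟨⟨hz, hact⟩, hvan⟩
    exact ⟨⟨⟨fun S ξ i x hx => hdeg i ▸ (hz S ξ i x hx).1,
        fun S T e ξ x => congrArg Prod.fst (hact S T e ξ x)⟩,
        fun S ξ x hx => congrArg Prod.fst (hvan S ξ x hx)⟩,
      ⟨fun S ξ i x hx => (hz S ξ i x hx).2,
        fun S T e ξ x => congrArg Prod.snd (hact S T e ξ x)⟩,
        fun S ξ x hx => congrArg Prod.snd (hvan S ξ x hx)⟩
  · rintro ⟨⟨⟨hφ, hφact⟩, hφvan⟩, ⟨hψ, hψact⟩, hψvan⟩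
    exact ⟨⟨fun S ξ i x hx => ⟨(hdeg i).symm ▸ hφ S ξ i x hx, hψ S ξ i x hx⟩,
      fun S T e ξ x => Prod.ext (hφact S T e ξ x) (hψact S T e ξ x)⟩,
      fun S ξ x hx => Prod.ext (hφvan S ξ x hx) (hψvan S ξ x hx)⟩

theorem pairEquivConeFamily_coneD (p : ℤ) (z : Families P A × Families P B) :
    pairEquivConeFamily f (coneD (convD P A) (convD P B) (pushforward P f) p z) =
      homD P.toDGCollection f.cone p (pairEquivConeFamily f z) := by
  funext S ξ
  refine LinearMap.ext fun x => Prod.ext ?_ ?_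
  · change -(A.d S ξ (z.1 S ξ x) - (p + 1).negOnePow • z.1 S ξ (P.d S ξ x)) =
      -A.d S ξ (z.1 S ξ x) - p.negOnePow • z.1 S ξ (P.d S ξ x)
    rw [Int.negOnePow_succ, Units.neg_smul, sub_neg_eq_add, neg_add']
  · change f.app S ξ (z.1 S ξ x) + (B.d S ξ (z.2 S ξ x) - p.negOnePow • z.2 S ξ (P.d S ξ x)) =
      f.app S ξ (z.1 S ξ x) + B.d S ξ (z.2 S ξ x) - p.negOnePow • z.2 S ξ (P.d S ξ x)
    rw [add_sub_assoc]

theorem isCochainMap_pushforward :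
    IsCochainMap (homVanishing V A.toDGCollection) (convD P A)
      (homVanishing V B.toDGCollection) (convD P B) (pushforward P f) where
  map_mem := by
    rintro p φ ⟨⟨hdeg, hact⟩, hvan⟩
    refine ⟨⟨fun S ξ i x hx => f.app_mem S ξ _ _ (hdeg S ξ i x hx), fun S T e ξ x => ?_⟩,
      fun S ξ x hx => ?_⟩
    · exact (congrArg (f.app T ξ) (hact S T e ξ x)).trans (f.app_act e ξ _)
    · exact (congrArg (f.app S ξ) (hvan S ξ x hx)).trans (map_zero _)
  comm p φ _ := by
    funext S ξ
    ext x
    change f.app S ξ (A.d S ξ (φ S ξ x) - p.negOnePow • φ S ξ (P.d S ξ x)) =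
      B.d S ξ (f.app S ξ (φ S ξ x)) - p.negOnePow • f.app S ξ (φ S ξ (P.d S ξ x))
    rw [map_sub, f.app_d, LinearMap.map_smul_of_tower]

variable {f}

theorem isQuasiIso_pushforward [CharZero K] (hf : f.IsQuasiIso)
    (hV : ∀ S ξ, ∀ x ∈ V S ξ, P.d S ξ x ∈ V S ξ) :
    IsQuasiIso (homVanishing V A.toDGCollection) (convD P A)
      (homVanishing V B.toDGCollection) (convD P B) (pushforward P f) := by
  obtain ⟨k⟩ := hf.nonempty_contraction_cone
  have hcone : IsAcyclic
      (coneGr (homVanishing V A.toDGCollection) (homVanishing V B.toDGCollection))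
      (coneD (convD P A) (convD P B) (pushforward P f)) :=
    k.isAcyclic_homVanishing.of_linearEquiv (pairEquivConeFamily f)
      (pairEquivConeFamily_mem_iff f) (pairEquivConeFamily_coneD f)
  exact ⟨isComplex_homVanishing hV, isComplex_homVanishing hV, isCochainMap_pushforward f,
    bijective_of_isAcyclic_cone (isCochainMap_pushforward f) hcone⟩

end Pushforward

namespace DGPseudoCooperad

variable {K : Type*} [Field K] {Ξ : Type*} {P : DGPseudoCooperad K Ξ}

/-- A graded dg coideal of `P`: a graded dg subcollection `V` such that the comultiplications carry
`V` to `V ⊗ P + P ⊗ V`. The families vanishing on it form a dg Lie subalgebra of `Conv(P, O)`. -/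
structure Coideal (P : DGPseudoCooperad K Ξ) where
  carrier : ∀ S ξ, Submodule K (P.obj S ξ)
  le_iSup_inf_gr : ∀ S ξ, carrier S ξ ≤ ⨆ i, carrier S ξ ⊓ P.gr S ξ i
  act_mem : ∀ {S T : CSet Ξ} (e : CIso S T) ξ, ∀ x ∈ carrier S ξ, P.act e ξ x ∈ carrier T ξ
  d_mem : ∀ S ξ, ∀ x ∈ carrier S ξ, P.d S ξ x ∈ carrier S ξ
  comul_mem : ∀ {S : CSet Ξ} (s : S.carrier) (T : CSet Ξ) {η : Ξ} (h : S.color s = η) (ξ : Ξ),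
    ∀ x ∈ carrier (S.ins s T) ξ,
      P.comul s T h ξ x ∈ tensorSub (carrier S ξ) ⊤ ⊔ tensorSub ⊤ (carrier T η)

/-- Each step of a filtration is a coideal. -/
def Filtration.coideal (F : P.Filtration) (m : ℕ) : P.Coideal where
  carrier := F.F m
  le_iSup_inf_gr S ξ := (F.graded m S ξ).le
  act_mem := F.act_mem m
  d_mem S ξ x hx := by
    cases m with
    | zero =>
      rw [F.zero, Submodule.mem_bot] at hx
      rw [hx, map_zero]
      exact zero_mem _
    | succ m => exact F.mono m S ξ (F.d_mem m S ξ x hx)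
  comul_mem {S} s T {η} h ξ x hx := by
    have hle : tensorSum (fun k => F.F k S ξ) (fun k => F.F k T η) m ≤
        tensorSub ⊤ (F.F m T η) := by
      refine iSup₂_le fun k hk => tensorSub_mono le_top ?_
      exact monotone_nat_of_le_succ (f := fun k => F.F k T η) (fun k => F.mono k T η)
        (hk ▸ Nat.le_add_left k.2 k.1)
    exact Submodule.mem_sup_right (hle (F.comul_mem m s T h ξ x hx))

end DGPseudoCooperad

section Bracket

variable {K : Type*} [Field K] {Ξ : Type*} {P : DGPseudoCooperad K Ξ}

section GraftTerm

variable {S : CSet Ξ} (s : S.carrier) (T : CSet Ξ) {η : Ξ} (h : S.color s = η) (ξ : Ξ)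
variable {R : CSet Ξ} (j : CIso (S.ins s T) R)

/-- The map `μ_t ∘ (φ ⊗ ψ) ∘ Δ_t`, with the signs of `treeTerm`, for the tree `t` obtained by
grafting the corolla with inputs `T` into the input `s` of the corolla with inputs `S`, with leaves
labelled by `R` through `j`. -/
noncomputable def graftTerm (O : DGOperad K Ξ) (q : ℤ) (φ ψ : Families P O) :
    P.obj R ξ →ₗ[K] O.obj R ξ :=
  O.act j ξ ∘ₗ TensorProduct.lift (O.comp s T h ξ) ∘ₗ
    TensorProduct.map (φ S ξ ∘ₗ signTwist (P.gr S ξ) (P.internal S ξ) q) (ψ T η) ∘ₗ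
    P.comul s T h ξ ∘ₗ P.act j.symm ξ

variable {O : DGOperad K Ξ} {p q : ℤ} {φ ψ : Families P O}

theorem graftTerm_mem (hφ : φ ∈ conv P O p) (hψ : ψ ∈ conv P O q) {k : ℤ} {x : P.obj R ξ}
    (hx : x ∈ P.gr R ξ k) : graftTerm s T h ξ j O q φ ψ x ∈ O.gr R ξ (k + (p + q)) := by
  have hle : tensorSum (P.gr S ξ) (P.gr T η) k ≤ (O.gr (S.ins s T) ξ (k + (p + q))).comap
      (TensorProduct.lift (O.comp s T h ξ) ∘ₗ
        TensorProduct.map (φ S ξ ∘ₗ signTwist (P.gr S ξ) (P.internal S ξ) q) (ψ T η)) := by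
    rw [tensorSum_le_iff]
    rintro i l rfl a ha b hb
    have hmem := O.comp_mem s T h ξ _ _ _
      (hφ.1 S ξ i _ (signTwist_mem (P.internal S ξ) q i ha)) _ (hψ.1 T η l b hb)
    rwa [add_add_add_comm] at hmem
  exact O.act_mem j ξ _ _ (hle (P.comul_mem s T h ξ k _ (P.act_mem j.symm ξ k x hx)))

theorem graftTerm_eq_zero (V : P.Coideal)
    (hφ : ∀ S ξ, ∀ x ∈ V.carrier S ξ, φ S ξ x = 0) (hψ : ∀ S ξ, ∀ x ∈ V.carrier S ξ, ψ S ξ x = 0)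
    {x : P.obj R ξ} (hx : x ∈ V.carrier R ξ) : graftTerm s T h ξ j O q φ ψ x = 0 := by
  have hle : tensorSub (V.carrier S ξ) ⊤ ⊔ tensorSub ⊤ (V.carrier T η) ≤ LinearMap.ker
      (TensorProduct.map (φ S ξ ∘ₗ signTwist (P.gr S ξ) (P.internal S ξ) q) (ψ T η)) := by
    simp only [sup_le_iff, tensorSub_le_iff, LinearMap.mem_ker, TensorProduct.map_tmul,
      LinearMap.comp_apply]
    refine ⟨fun a ha b _ => ?_, fun a _ b hb => ?_⟩
    · rw [hφ S ξ _ (signTwist_mem_of_le_iSup_inf (P.internal S ξ) q (V.le_iSup_inf_gr S ξ) ha),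
        TensorProduct.zero_tmul]
    · rw [hψ T η b hb, TensorProduct.tmul_zero]
  simp only [graftTerm, LinearMap.comp_apply]
  rw [LinearMap.mem_ker.1 (hle (V.comul_mem s T h ξ _ (V.act_mem j.symm ξ x hx))), map_zero,
    map_zero]

theorem graftTerm_act (hφ : φ ∈ conv P O p) (hψ : ψ ∈ conv P O q) {S' T' R' : CSet Ξ}
    (eS : CIso S S') (eT : CIso T T') (h' : S'.color (eS.toEquiv s) = η)
    {j' : CIso (S'.ins (eS.toEquiv s) T') R'} {e : CIso R R'}
    (hj : (CSet.insMap eS s eT).trans j' = j.trans e) (x : P.obj R ξ) :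
    graftTerm (eS.toEquiv s) T' h' ξ j' O q φ ψ (P.act e ξ x) =
      O.act e ξ (graftTerm s T h ξ j O q φ ψ x) := by
  obtain ⟨y, rfl⟩ : ∃ y, P.act j ξ y = x := ⟨_, P.act_act_symm j ξ x⟩
  simp only [graftTerm, LinearMap.comp_apply]
  rw [P.act_symm_act, ← O.act_trans j, ← P.act_trans j, ← hj, O.act_trans, P.act_trans,
    P.act_symm_act, P.comul_act eS eT s h h']
  generalize P.comul s T h ξ y = z
  induction z using TensorProduct.induction_on with
  | zero => simp only [map_zero]
  | tmul a b =>
    simp only [TensorProduct.map_tmul, TensorProduct.lift.tmul, LinearMap.comp_apply]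
    rw [← O.comp_act eS eT s h h' ξ, ← hφ.2, ← hψ.2,
      map_signTwist (P.internal S ξ) (P.internal S' ξ) q _ (P.act_mem eS ξ)]
  | add z z' hz hz' => simp only [map_add, hz, hz']

theorem app_graftTerm {B : DGOperad K Ξ} (f : O.Hom B) (x : P.obj R ξ) :
    f.app R ξ (graftTerm s T h ξ j O q φ ψ x) =
      graftTerm s T h ξ j B q (pushforward P f φ) (pushforward P f ψ) x := by
  simp only [graftTerm, LinearMap.comp_apply, f.app_act]
  generalize P.comul s T h ξ (P.act j.symm ξ x) = z
  induction z using TensorProduct.induction_on with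
  | zero => simp only [map_zero]
  | tmul a b => exact congrArg (B.act j ξ) (f.app_comp s T h ξ _ _)
  | add z z' hz hz' => simp only [map_add, hz, hz']

end GraftTerm

variable {O : DGOperad K Ξ} {p q : ℤ} {φ ψ : Families P O}

theorem treeTerm_act (hφ : φ ∈ conv P O p) (hψ : ψ ∈ conv P O q) {R R' : CSet Ξ}
    (e : CIso R R') (ξ : Ξ) (T : Set R'.carrier) (η : Ξ) (x : P.obj R ξ) :
    treeTerm P O q φ ψ R' ξ T η (P.act e ξ x) =
      O.act e ξ (treeTerm P O q φ ψ R ξ (e.toEquiv ⁻¹' T) η x) :=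
  graftTerm_act (S := R.quot (e.toEquiv ⁻¹' T) η) none _ rfl ξ _ hφ hψ (e.quotMap T η)
    (e.subMap T) rfl (e.insMap_trans_join T η) x

theorem preLie_apply (R : CSet Ξ) (ξ : Ξ) (x : P.obj R ξ) :
    preLie P O q φ ψ R ξ x = ∑ᶠ t : Set R.carrier × Ξ, treeTerm P O q φ ψ R ξ t.1 t.2 x := rfl

theorem preLie_act (hφ : φ ∈ conv P O p) (hψ : ψ ∈ conv P O q) {R R' : CSet Ξ}
    (e : CIso R R') (ξ : Ξ) (x : P.obj R ξ) :
    preLie P O q φ ψ R' ξ (P.act e ξ x) = O.act e ξ (preLie P O q φ ψ R ξ x) := by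
  have hpre (T : Set R'.carrier) : (Equiv.Set.congr e.toEquiv).symm T = e.toEquiv ⁻¹' T :=
    e.toEquiv.symm.image_eq_preimage_symm T
  rw [preLie_apply, preLie_apply, map_finsum (O.act e ξ) (treeTerm_finite P O q φ ψ R ξ x),
    ← finsum_comp_equiv ((Equiv.Set.congr e.toEquiv).symm.prodCongr (Equiv.refl Ξ))]
  refine finsum_congr fun t => ?_
  rw [treeTerm_act hφ hψ, Equiv.prodCongr_apply, Prod.map_fst, Prod.map_snd, hpre,
    Equiv.refl_apply]

theorem preLie_mem_homVanishing (V : P.Coideal)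
    (hφ : φ ∈ homVanishing V.carrier O.toDGCollection p)
    (hψ : ψ ∈ homVanishing V.carrier O.toDGCollection q) :
    preLie P O q φ ψ ∈ homVanishing V.carrier O.toDGCollection (p + q) := by
  refine ⟨⟨fun R ξ k x hx => ?_, fun R R' e ξ x => preLie_act hφ.1 hψ.1 e ξ x⟩,
    fun R ξ x hx => ?_⟩
  · rw [preLie_apply]
    exact finsum_induction (· ∈ O.gr R ξ (k + (p + q))) (zero_mem _) (fun _ _ => add_mem)
      fun t => graftTerm_mem _ _ _ ξ (R.join t.1 t.2) hφ.1 hψ.1 hx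
  · rw [preLie_apply]
    exact finsum_eq_zero_of_forall_eq_zero fun t =>
      graftTerm_eq_zero _ _ _ ξ (R.join t.1 t.2) V hφ.2 hψ.2 hx

theorem convBracket_mem_homVanishing (V : P.Coideal)
    (hφ : φ ∈ homVanishing V.carrier O.toDGCollection p)
    (hψ : ψ ∈ homVanishing V.carrier O.toDGCollection q) :
    convBracket P O p q φ ψ ∈ homVanishing V.carrier O.toDGCollection (p + q) :=
  sub_mem (preLie_mem_homVanishing V hφ hψ)
    (Submodule.smul_of_tower_mem _ _ (add_comm q p ▸ preLie_mem_homVanishing V hψ hφ))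

variable {B : DGOperad K Ξ} (f : O.Hom B)

theorem pushforward_preLie (q : ℤ) (φ ψ : Families P O) :
    pushforward P f (preLie P O q φ ψ) =
      preLie P B q (pushforward P f φ) (pushforward P f ψ) := by
  funext R ξ
  ext x
  change f.app R ξ (preLie P O q φ ψ R ξ x) = _
  rw [preLie_apply, preLie_apply, map_finsum (f.app R ξ) (treeTerm_finite P O q φ ψ R ξ x)]
  exact finsum_congr fun t => app_graftTerm _ _ _ ξ (R.join t.1 t.2) f x

theorem pushforward_convBracket (p q : ℤ) (φ ψ : Families P O) :
    pushforward P f (convBracket P O p q φ ψ) =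
      convBracket P B p q (pushforward P f φ) (pushforward P f ψ) := by
  rw [convBracket, map_sub, LinearMap.map_smul_of_tower, pushforward_preLie, pushforward_preLie,
    convBracket]

end Bracket

end ConvOperad

theorem mainTheorem7_general {K : Type*} [Field K] [CharZero K] {Ξ : Type*}
    (P : ConvOperad.DGPseudoCooperad K Ξ) (V : P.Coideal)
    (A B : ConvOperad.DGOperad K Ξ) (f : A.Hom B) (hf : f.IsQuasiIso) :
    (∀ p q, ∀ φ ∈ ConvOperad.homVanishing V.carrier A.toDGCollection p,
      ∀ ψ ∈ ConvOperad.homVanishing V.carrier A.toDGCollection q,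
      ConvOperad.convBracket P A p q φ ψ ∈
        ConvOperad.homVanishing V.carrier A.toDGCollection (p + q)) ∧
    (∀ p q, ∀ φ ∈ ConvOperad.homVanishing V.carrier B.toDGCollection p,
      ∀ ψ ∈ ConvOperad.homVanishing V.carrier B.toDGCollection q,
      ConvOperad.convBracket P B p q φ ψ ∈
        ConvOperad.homVanishing V.carrier B.toDGCollection (p + q)) ∧
    (∀ p q φ ψ, ConvOperad.pushforward P f (ConvOperad.convBracket P A p q φ ψ) =
      ConvOperad.convBracket P B p q
        (ConvOperad.pushforward P f φ) (ConvOperad.pushforward P f ψ)) ∧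
    ConvOperad.IsQuasiIso
      (ConvOperad.homVanishing V.carrier A.toDGCollection) (ConvOperad.convD P A)
      (ConvOperad.homVanishing V.carrier B.toDGCollection) (ConvOperad.convD P B)
      (ConvOperad.pushforward P f) :=
  ⟨fun _ _ _ hφ _ hψ => ConvOperad.convBracket_mem_homVanishing V hφ hψ,
    fun _ _ _ hφ _ hψ => ConvOperad.convBracket_mem_homVanishing V hφ hψ,
    ConvOperad.pushforward_convBracket f, ConvOperad.isQuasiIso_pushforward hf V.d_mem⟩

theorem mainTheorem7 {K : Type*} [Field K] [CharZero K] {Ξ : Type*}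
    (P : ConvOperad.DGPseudoCooperad K Ξ) (F : P.Filtration)
    (A B : ConvOperad.DGOperad K Ξ) (f : A.Hom B) (hf : f.IsQuasiIso) (m : ℕ) (hm : 1 ≤ m) :
    -- `F_m Conv(P, A)` and `F_m Conv(P, B)` are closed under the brackets
    (∀ p q, ∀ φ ∈ ConvOperad.convFil F A m p, ∀ ψ ∈ ConvOperad.convFil F A m q,
      ConvOperad.convBracket P A p q φ ψ ∈ ConvOperad.convFil F A m (p + q)) ∧
    (∀ p q, ∀ φ ∈ ConvOperad.convFil F B m p, ∀ ψ ∈ ConvOperad.convFil F B m q,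
      ConvOperad.convBracket P B p q φ ψ ∈ ConvOperad.convFil F B m (p + q)) ∧
    -- `f_*` preserves the brackets
    (∀ p q, ∀ φ ∈ ConvOperad.convFil F A m p, ∀ ψ ∈ ConvOperad.convFil F A m q,
      ConvOperad.pushforward P f (ConvOperad.convBracket P A p q φ ψ) =
        ConvOperad.convBracket P B p q
          (ConvOperad.pushforward P f φ) (ConvOperad.pushforward P f ψ)) ∧
    -- `f_*` is a quasi-isomorphism of cochain complexes `F_m Conv(P, A) → F_m Conv(P, B)`
    ConvOperad.IsQuasiIso
      (ConvOperad.convFil F A m) (ConvOperad.convD P A)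
      (ConvOperad.convFil F B m) (ConvOperad.convD P B)
      (ConvOperad.pushforward P f) := by
  obtain ⟨hA, hB, hbr, hq⟩ := mainTheorem7_general P (F.coideal (m - 1)) A B f hf
  exact ⟨hA, hB, fun p q φ _ ψ _ => hbr p q φ ψ, hq⟩
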